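/- Let $M$ be a smooth manifold of dimension $n+p$ with a smooth $p$-dimensional foliation $\mathcal F$; let $\mathcal D_{\mathcal F}\subset TM$ be its tangent distribution and $\mathcal D$ a smooth distribution with $TM=\mathcal D\oplus\mathcal D_{\mathcal F}$, with projections $v\mapsto v^\perp\in\mathcal D$, $v\mapsto v^{\mathcal F}\in\mathcal D_{\mathcal F}$. For a Riemannian metric $g$ with $\mathcal D\perp\mathcal D_{\mathcal F}$ and Levi-Civita connection $\nabla$ put $$h(X,Y)=\tfrac12(\nabla_XY+\nabla_YX)^{\mathcal F},\quad T(X,Y)=\tfrac12[X,Y]^{\mathcal F}\quad(X,Y\in\mathcal D),\qquad h_{\mathcal F}(X,Y)=(\nabla_XY)^\perp\quad(X,Y\in\mathcal D_{\mathcal F}),$$ $H=\mathrm{tr}_g h$, $\beta_{\mathcal D}=n^{-2}(n\|h\|^2-\|H\|^2)$, $\nabla^{\mathcal F}f=(\nabla f)^{\mathcal F}$, $\mathrm{Div}_{\mathcal F}X=\sum_{\alpha}g(\nabla_{\mathcal E_\alpha}X,\mathcal E_\alpha)$ for a $g$-orthonormal basis $(\mathcal E_\alpha)$ of $\mathcal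 D_{\mathcal F}$, $\Delta_{\mathcal F}u=\mathrm{Div}_{\mathcal F}(\nabla^{\mathcal F}u)$ and $\mathcal H(u)=-\Delta_{\mathcal F}u-\beta_{\mathcal D}u$ (the leaf-wise Schrödinger operator). Norms of tensors are computed in $g$-orthonormal bases of $\mathcal D$, respectively $\mathcal D_{\mathcal F}$. Let $0<t_0\le\infty$ and let $(g_t)_{0\le t<t_0}$ be a smooth family of Riemannian metrics on $M$ with $\mathcal D\perp\mathcal D_{\mathcal F}$ such that $\partial_tg=s\,g^\perp$, where $s=s_t(x)$ is a smooth function on $[0,t_0)\times M$ and $g^\perp(v,w)=g(v^\perp,w^\perp)$. Assume that the mean curvature vector of $\mathcal D$ at time $0$ is $H_0=-n\nabla^{\mathcal F}\log u_0$ for some positive $u_0\in C^\infty(M)$. Let $$U=\{x\in M:\ \Psi_1\Psi_2\neq0\},\qquad \Psi_1=u_0^2\|h_{\mathcal F}\|_{g_0}^2,\quad \Psi_2=u_0^4\|T\|_{g_0}^2 .$$ Then: 1. the function $\beta_{\mathcal D}$ does not depend on $t$ (on all of $M$); 2. for all $t\in[0,t_0)$ the functions $\|T\|_{g_t}$ and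 $\|h_{\mathcal F}\|_{g_t}$ are positive and differentiable at every point of $U$, and on $U$ the function $\|h_{\mathcal F}\|^2/\|T\|$ and the vector fields $H-\frac n2\nabla^{\mathcal F}\log\|T\|$ and $H-n\nabla^{\mathcal F}\log\|h_{\mathcal F}\|$ do not depend on $t$; 3. the leaf-wise Schrödinger operator does not depend on $t$: for every $x\in M$ and every function $u$ of class $C^2$ near $x$, $\mathcal H_{g_t}(u)(x)=\mathcal H_{g_0}(u)(x)$ for all $t\in[0,t_0)$. -/

import Mathlib

open Set Bundle Manifold
open scoped Manifold ContDiff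

noncomputable section

namespace FoliatedFlow

/-- The model vector space `ℝ^{n+p}`. -/
abbrev Model (n p : ℕ) : Type := EuclideanSpace ℝ (Fin (n + p))

/-! ### Foliations and complementary distributions -/

section Foliations

variable {n p : ℕ} {M : Type*} [TopologicalSpace M] [ChartedSpace (Model n p) M]
  [IsManifold (𝓡 (n + p)) ∞ M]

/-- `φ` is a smooth chart with convex image which is flat for the field of subspaces `P`:
there is a `p`-dimensional subspace `W` of `ℝ^{n+p}` such that the plaques
`{y | φ y - φ z ∈ W}` of the chart are tangent to `P`. -/
def IsFlatChart (P : (x : M) → Submodule ℝ (TangentSpace (𝓡 (n + p)) x))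
    (φ : OpenPartialHomeomorph M (Model n p)) (W : Submodule ℝ (Model n p)) : Prop :=
  φ ∈ IsManifold.maximalAtlas (𝓡 (n + p)) ∞ M ∧
  Convex ℝ φ.target ∧
  Module.finrank ℝ W = p ∧
  ∀ y ∈ φ.source, ∀ v : TangentSpace (𝓡 (n + p)) y,
    v ∈ P y ↔ mvfderiv (𝓡 (n + p)) φ y v ∈ W

variable (n p M) in
/-- A smooth `p`-dimensional foliation of the `(n+p)`-dimensional manifold `M`, given by its tangent
distribution together with a covering of `M` by foliation charts. -/
structure Foliation where
  /-- The distribution `𝒟_𝓕` tangent to the leaves. -/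
  tangent : (x : M) → Submodule ℝ (TangentSpace (𝓡 (n + p)) x)
  exists_flatChart : ∀ x : M, ∃ φ W, x ∈ φ.source ∧ IsFlatChart tangent φ W

/-- The partition of `M` into the leaves: two points are on the same leaf if they are connected by a
finite chain of plaques. -/
def Foliation.leaf (F : Foliation n p M) : Setoid M :=
  Relation.EqvGen.setoid fun y z => ∃ φ W, IsFlatChart F.tangent φ W ∧
    y ∈ φ.source ∧ z ∈ φ.source ∧ φ y - φ z ∈ W

/-- A smooth distribution `𝒟` on `M` complementary to the tangent distribution of the foliation.
Smoothness is expressed by saying that the projection onto `𝒟` along `𝒟_𝓕` preserves smoothness of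
vector fields. -/
structure TransversalDistribution (F : Foliation n p M) where
  carrier : (x : M) → Submodule ℝ (TangentSpace (𝓡 (n + p)) x)
  isCompl : ∀ x, IsCompl (carrier x) (F.tangent x)
  contMDiffAt_projection : ∀ (X : (x : M) → TangentSpace (𝓡 (n + p)) x) (x : M),
    ContMDiffAt (𝓡 (n + p)) (𝓡 (n + p)).tangent ∞ (T% X) x →
    ContMDiffAt (𝓡 (n + p)) (𝓡 (n + p)).tangent ∞
      (T% (fun y => (carrier y).projection (F.tangent y) (isCompl y) (X y))) x

variable {F : Foliation n p M} (D : TransversalDistribution F)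

/-- `v ↦ v^⊥`, the projection onto `𝒟` along `𝒟_𝓕`. -/
def TransversalDistribution.perp (x : M) :
    TangentSpace (𝓡 (n + p)) x →ₗ[ℝ] TangentSpace (𝓡 (n + p)) x :=
  (D.carrier x).projection (F.tangent x) (D.isCompl x)

/-- `v ↦ v^𝓕`, the projection onto `𝒟_𝓕` along `𝒟`. -/
def TransversalDistribution.tang (x : M) :
    TangentSpace (𝓡 (n + p)) x →ₗ[ℝ] TangentSpace (𝓡 (n + p)) x :=
  (F.tangent x).projection (D.carrier x) (D.isCompl x).symm

/-- A (locally defined, smooth near `x`) section of `𝒟` with value `v^⊥` at `x`. -/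
def TransversalDistribution.perpExtend {x : M} (v : TangentSpace (𝓡 (n + p)) x) (y : M) :
    TangentSpace (𝓡 (n + p)) y :=
  D.perp y (FiberBundle.extend (Model n p) v y)

/-- A (locally defined, smooth near `x`) section of `𝒟_𝓕` with value `v^𝓕` at `x`. -/
def TransversalDistribution.tangExtend {x : M} (v : TangentSpace (𝓡 (n + p)) x) (y : M) :
    TangentSpace (𝓡 (n + p)) y :=
  D.tang y (FiberBundle.extend (Model n p) v y)

end Foliations

/-! ### Riemannian metrics -/

section Metrics

variable {n p : ℕ} {M : Type*} [TopologicalSpace M] [ChartedSpace (Model n p) M]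
  [IsManifold (𝓡 (n + p)) ∞ M]

variable (n p M) in
/-- Smooth Riemannian metrics on `M`. -/
abbrev Metric : Type _ :=
  ContMDiffRiemannianMetric (𝓡 (n + p)) ∞ (Model n p)
    (fun x : M => TangentSpace (𝓡 (n + p)) x)

variable (g : Metric n p M)

/-- Every subspace of a tangent space has a `g`-orthonormal basis. -/
theorem exists_orthonormal (x : M) (V : Submodule ℝ (TangentSpace (𝓡 (n + p)) x)) :
    ∃ e : Fin (Module.finrank ℝ V) → TangentSpace (𝓡 (n + p)) x,
      (∀ i, e i ∈ V) ∧ ∀ i j, g.inner x (e i) (e j) = if i = j then 1 else 0 := by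
  let c : InnerProductSpace.Core ℝ V :=
    { inner := fun v w => g.inner x v w
      conj_inner_symm := fun v w => by simpa using g.symm x w v
      re_inner_nonneg := fun v => by
        rcases eq_or_ne v 0 with rfl | hv
        · simp
        · simpa using (g.pos x v (by simpa using hv)).le
      add_left := fun v w z => by simp
      smul_left := fun v w r => by simp
      definite := fun v h => by
        by_contra hv
        exact (g.pos x v (by simpa using hv)).ne' h }
  let _ : NormedAddCommGroup V := c.toNormedAddCommGroup
  let _ : InnerProductSpace ℝ V := InnerProductSpace.ofCore c.toCore
  have hfin : FiniteDimensional ℝ (TangentSpace (𝓡 (n + p)) x) :=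
    inferInstanceAs (FiniteDimensional ℝ (Model n p))
  let b := stdOrthonormalBasis ℝ V
  refine ⟨fun i => (b i : TangentSpace (𝓡 (n + p)) x), fun i => (b i).2, fun i j => ?_⟩
  exact (orthonormal_iff_ite.mp b.orthonormal) i j

/-- A `g`-orthonormal basis of a subspace `V` of the tangent space at `x`. -/
def orthoBasis (x : M) (V : Submodule ℝ (TangentSpace (𝓡 (n + p)) x)) :
    Fin (Module.finrank ℝ V) → TangentSpace (𝓡 (n + p)) x :=
  (exists_orthonormal g x V).choose

/-- The right-hand side of the Koszul formula,
`X g(Y,Z) + Y g(X,Z) - Z g(X,Y) + g([X,Y],Z) - g([X,Z],Y) - g([Y,Z],X)`, at the point `x`. -/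
def koszul (X Y Z : (x : M) → TangentSpace (𝓡 (n + p)) x) (x : M) : ℝ :=
  mvfderiv (𝓡 (n + p)) (fun y => g.inner y (Y y) (Z y)) x (X x)
  + mvfderiv (𝓡 (n + p)) (fun y => g.inner y (X y) (Z y)) x (Y x)
  - mvfderiv (𝓡 (n + p)) (fun y => g.inner y (X y) (Y y)) x (Z x)
  + g.inner x (VectorField.mlieBracket (𝓡 (n + p)) X Y x) (Z x)
  - g.inner x (VectorField.mlieBracket (𝓡 (n + p)) X Z x) (Y x)
  - g.inner x (VectorField.mlieBracket (𝓡 (n + p)) Y Z x) (X x)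

/-- The Levi-Civita connection `∇_X Y` at `x`: the vector whose component along each vector `e a`
of an orthonormal basis is given by the Koszul formula. -/
def leviCivita (X Y : (x : M) → TangentSpace (𝓡 (n + p)) x) (x : M) :
    TangentSpace (𝓡 (n + p)) x :=
  ∑ a, ((1 / 2 : ℝ) * koszul g X Y
    (FiberBundle.extend (Model n p) (orthoBasis g x ⊤ a)) x) • orthoBasis g x ⊤ a

/-- The gradient `∇ f` at `x`. -/
def gradient (f : M → ℝ) (x : M) : TangentSpace (𝓡 (n + p)) x :=
  ∑ a, (mvfderiv (𝓡 (n + p)) f x (orthoBasis g x ⊤ a)) • orthoBasis g x ⊤ a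

/-! ### Extrinsic geometry of the pair `(𝒟, 𝒟_𝓕)` -/

variable {F : Foliation n p M} (D : TransversalDistribution F)

/-- `g` is adapted: `𝒟_𝓕` is `g`-orthogonal to `𝒟`. -/
def IsAdapted : Prop :=
  ∀ x, ∀ v ∈ D.carrier x, ∀ w ∈ F.tangent x, g.inner x v w = 0

/-- The second fundamental tensor of `𝒟`: `h(X,Y) = ½ (∇_X Y + ∇_Y X)^𝓕` for `X, Y ∈ 𝒟`. -/
def secondFund (x : M) (v w : TangentSpace (𝓡 (n + p)) x) : TangentSpace (𝓡 (n + p)) x :=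
  (1 / 2 : ℝ) • D.tang x (leviCivita g (D.perpExtend v) (D.perpExtend w) x
    + leviCivita g (D.perpExtend w) (D.perpExtend v) x)

/-- The integrability tensor of `𝒟`: `T(X,Y) = ½ [X,Y]^𝓕` for `X, Y ∈ 𝒟`. -/
def integrability (x : M) (v w : TangentSpace (𝓡 (n + p)) x) : TangentSpace (𝓡 (n + p)) x :=
  (1 / 2 : ℝ) • D.tang x
    (VectorField.mlieBracket (𝓡 (n + p)) (D.perpExtend v) (D.perpExtend w) x)

/-- The second fundamental tensor of the foliation: `h_𝓕(X,Y) = (∇_X Y)^⊥` for `X, Y ∈ 𝒟_𝓕`. -/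
def leafSecondFund (x : M) (v w : TangentSpace (𝓡 (n + p)) x) : TangentSpace (𝓡 (n + p)) x :=
  D.perp x (leviCivita g (D.tangExtend v) (D.tangExtend w) x)

/-- The mean curvature vector `H = tr_g h` of `𝒟`. -/
def meanCurvature (x : M) : TangentSpace (𝓡 (n + p)) x :=
  ∑ i, secondFund g D x (orthoBasis g x (D.carrier x) i) (orthoBasis g x (D.carrier x) i)

/-- The squared norm `∑ᵢⱼ g(B(eᵢ,eⱼ), B(eᵢ,eⱼ))` of a vector-valued bilinear map `B` on a subspace
`V` of the tangent space at `x`, where `e` is a `g`-orthonormal basis of `V`. -/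
def normSq (x : M) (V : Submodule ℝ (TangentSpace (𝓡 (n + p)) x))
    (B : TangentSpace (𝓡 (n + p)) x → TangentSpace (𝓡 (n + p)) x →
      TangentSpace (𝓡 (n + p)) x) : ℝ :=
  ∑ i, ∑ j, g.inner x (B (orthoBasis g x V i) (orthoBasis g x V j))
    (B (orthoBasis g x V i) (orthoBasis g x V j))

/-- `‖T‖`. -/
def normT (x : M) : ℝ :=
  Real.sqrt (normSq g x (D.carrier x) (integrability D x))

/-- `‖h_𝓕‖`. -/
def normLeafSecondFund (x : M) : ℝ :=
  Real.sqrt (normSq g x (F.tangent x) (leafSecondFund g D x))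

/-- `β_𝒟 = n⁻² (n ‖h‖² - ‖H‖²)`. -/
def beta (x : M) : ℝ :=
  ((n : ℝ) ^ 2)⁻¹ * ((n : ℝ) * normSq g x (D.carrier x) (secondFund g D x)
    - g.inner x (meanCurvature g D x) (meanCurvature g D x))

/-- The leaf-wise gradient `∇^𝓕 f = (∇ f)^𝓕`. -/
def leafGradient (f : M → ℝ) (x : M) : TangentSpace (𝓡 (n + p)) x :=
  D.tang x (gradient g f x)

variable (F) in
/-- The leaf-wise divergence `Div_𝓕 X = ∑_α g(∇_α X, ℰ_α)`, where `ℰ` is an orthonormal basis of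
`𝒟_𝓕`. -/
def leafDiv (X : (x : M) → TangentSpace (𝓡 (n + p)) x) (x : M) : ℝ :=
  ∑ a, g.inner x
    (leviCivita g (FiberBundle.extend (Model n p) (orthoBasis g x (F.tangent x) a)) X x)
    (orthoBasis g x (F.tangent x) a)

/-- The leaf-wise Laplacian `Δ_𝓕 u = Div_𝓕 (∇^𝓕 u)`. -/
def leafLaplacian (u : M → ℝ) (x : M) : ℝ :=
  leafDiv g F (leafGradient g D u) x

/-- The leaf-wise Schrödinger operator `ℋ u = -Δ_𝓕 u - β_𝒟 u`. -/
def schrodinger (u : M → ℝ) (x : M) : ℝ :=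
  -leafLaplacian g D u x - beta g D x * u x

/-! ### Conformal variations -/

/-- The time interval `[0, t₀)`, with `0 < t₀ ≤ ∞`. -/
def timeInterval (t₀ : EReal) : Set ℝ := {t : ℝ | 0 ≤ t ∧ (t : EReal) < t₀}

/-- The metrics `g t`, `t ∈ J`, are a smooth `𝒟`-conformal adapted variation `∂ₜ g = s g^⊥`, where
`s` is a smooth function on `J × M` and `g^⊥(v,w) = g(v^⊥,w^⊥)`. -/
structure IsConformalVariation (J : Set ℝ) (g : ℝ → Metric n p M) (s : ℝ → M → ℝ) : Prop where
  adapted : ∀ t ∈ J, IsAdapted (g t) D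
  smooth : ContMDiffOn (𝓘(ℝ, ℝ).prod (𝓡 (n + p)))
    ((𝓡 (n + p)).prod 𝓘(ℝ, Model n p →L[ℝ] Model n p →L[ℝ] ℝ)) ∞
    (fun q : ℝ × M => TotalSpace.mk' (Model n p →L[ℝ] Model n p →L[ℝ] ℝ)
      (E := fun x : M => TangentSpace (𝓡 (n + p)) x →L[ℝ] TangentSpace (𝓡 (n + p)) x →L[ℝ] ℝ)
      q.2 ((g q.1).inner q.2))
    (J ×ˢ univ)
  smooth_speed : ContMDiffOn (𝓘(ℝ, ℝ).prod (𝓡 (n + p))) 𝓘(ℝ, ℝ) ∞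
    (fun q : ℝ × M => s q.1 q.2) (J ×ˢ univ)
  evolution : ∀ t ∈ J, ∀ (x : M) (v w : TangentSpace (𝓡 (n + p)) x),
    HasDerivWithinAt (fun τ => (g τ).inner x v w)
      (s t x * (g t).inner x (D.perp x v) (D.perp x w)) J t

/-- The domain `U = {Ψ₁ Ψ₂ ≠ 0}`, with `Ψ₁ = u₀² ‖h_𝓕‖²` and `Ψ₂ = u₀⁴ ‖T‖²` for the metric `g`. -/
def domainU (u₀ : M → ℝ) : Set M :=
  {x | (u₀ x ^ 2 * normLeafSecondFund g D x ^ 2) * (u₀ x ^ 4 * normT g D x ^ 2) ≠ 0}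

end Metrics

end FoliatedFlow

end

namespace FoliatedFlow

noncomputable section

/-! ### Linear algebra of two metrics on one tangent space -/

section FiberAlgebra

variable {n p : ℕ} {M : Type*} [TopologicalSpace M] [ChartedSpace (Model n p) M]
  [IsManifold (𝓡 (n + p)) ∞ M] (g g' : Metric n p M) {x : M}

/-! The flow is never integrated explicitly. Since `∂ₜ g = s g^⊥`, products with a leaf-tangent
vector are constant in time. For nonzero `e ∈ 𝒟` and `v, w ∈ 𝒟` the quotient `g_t(v,w) / g_t(e,e)`
has zero time derivative. Hence any two metrics of the family agree along the leaves and differ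
along `𝒟` by a positive factor `ρ(x)` (`exists_isConformalChange`), and the theorem becomes a
comparison of two fixed metrics `g` and `g'`.

That comparison rests on the Koszul formula: `h`, `h_𝓕` and `Div_𝓕` are all given by Lie derivatives
of the metric (`inner_secondFund`, `inner_leafSecondFund`, `leafDiv_eq_sum_lieMetricForm`). For
`h_𝓕` this uses integrability of the foliation (`Foliation.mlieBracket_mem`). The product rule then
gives `h' = ρ h - ½ g^⊥ ∇^𝓕 ρ`, `h_𝓕' = ρ⁻¹ h_𝓕`, `H' = H - (n/2) ∇^𝓕 log ρ`, while `T`, `∇^𝓕` and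
`Div_𝓕` on differentiable fields do not change. So `‖T‖` scales by `ρ⁻¹` and `‖h_𝓕‖` by `ρ^(-1/2)`;
their logarithmic gradients offset the change of `H`. For `n > 0`, `n β_𝒟` is the squared norm of
the trace-free part of `h`, which the `∇^𝓕 ρ` term does not touch, and the remaining powers of `ρ`
cancel. Invariance of `ℋ` follows.

The rest is regularity. Orthonormal bases and extensions of vectors are chosen separately at each
point, so norms and gradients are rewritten in a smooth local frame with the inverse Gram matrix
before being differentiated. -/

instance finiteDimensional_tangentSpace (x : M) :
    FiniteDimensional ℝ (TangentSpace (𝓡 (n + p)) x) :=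
  inferInstanceAs (FiniteDimensional ℝ (Model n p))

theorem orthoBasis_mem (V : Submodule ℝ (TangentSpace (𝓡 (n + p)) x))
    (i : Fin (Module.finrank ℝ V)) : orthoBasis g x V i ∈ V :=
  (exists_orthonormal g x V).choose_spec.1 i

theorem inner_orthoBasis (V : Submodule ℝ (TangentSpace (𝓡 (n + p)) x))
    (i j : Fin (Module.finrank ℝ V)) :
    g.inner x (orthoBasis g x V i) (orthoBasis g x V j) = if i = j then 1 else 0 :=
  (exists_orthonormal g x V).choose_spec.2 i j

/-- Orthonormality forces linear independence, and the family has exactly `finrank V` members, so it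
is a basis of `V`. -/
theorem sum_inner_smul_orthoBasis {V : Submodule ℝ (TangentSpace (𝓡 (n + p)) x)}
    {v : TangentSpace (𝓡 (n + p)) x} (hv : v ∈ V) :
    ∑ i, g.inner x v (orthoBasis g x V i) • orthoBasis g x V i = v := by
  let e : Fin (Module.finrank ℝ V) → V := fun i => ⟨orthoBasis g x V i, orthoBasis_mem g V i⟩
  have coeff : ∀ (c : Fin (Module.finrank ℝ V) → ℝ) (j),
      g.inner x (∑ i, c i • orthoBasis g x V i) (orthoBasis g x V j) = c j := by
    intro c j
    simp [inner_orthoBasis]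
  have hli : LinearIndependent ℝ e := by
    rw [Fintype.linearIndependent_iff]
    intro c hc j
    have : ∑ i, c i • orthoBasis g x V i = 0 := by
      simpa [e] using congrArg (Subtype.val) hc
    rw [← coeff c j, this]
    simp
  let b := Module.Basis.mk hli (hli.span_eq_top_of_card_eq_finrank' (by simp)).ge
  have hb : ∀ i, ((b i : V) : TangentSpace (𝓡 (n + p)) x) = orthoBasis g x V i := by
    intro i
    simp [b, e]
  have hsum : ∑ i, b.repr ⟨v, hv⟩ i • orthoBasis g x V i = v := by
    have := congrArg V.subtype (b.sum_repr ⟨v, hv⟩)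
    rw [map_sum] at this
    simpa only [map_smul, Submodule.subtype_apply, hb] using this
  conv_rhs => rw [← hsum]
  refine Finset.sum_congr rfl fun i _ => ?_
  congr 1
  conv_lhs => rw [← hsum]
  exact coeff _ i

/-- The standard way below to identify tensor values: both sides lie in `𝒟` or in `𝒟_𝓕`, so testing
against that subspace alone suffices. -/
theorem eq_of_inner_eq {V : Submodule ℝ (TangentSpace (𝓡 (n + p)) x)}
    {v w : TangentSpace (𝓡 (n + p)) x} (hv : v ∈ V) (hw : w ∈ V)
    (h : ∀ z ∈ V, g.inner x v z = g.inner x w z) : v = w := by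
  rw [← sum_inner_smul_orthoBasis g hv, ← sum_inner_smul_orthoBasis g hw]
  exact Finset.sum_congr rfl fun i _ => by rw [h _ (orthoBasis_mem g V i)]

/-- The trace of a bilinear map over a subspace on which two metrics are proportional. -/
theorem sum_orthoBasis_of_conformal {E : Type*} [AddCommGroup E] [Module ℝ E]
    {V : Submodule ℝ (TangentSpace (𝓡 (n + p)) x)} {c : ℝ} (hc : c ≠ 0)
    (h : ∀ v ∈ V, ∀ w ∈ V, g'.inner x v w = c * g.inner x v w)
    (B : TangentSpace (𝓡 (n + p)) x →ₗ[ℝ] TangentSpace (𝓡 (n + p)) x →ₗ[ℝ] E) :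
    ∑ i, B (orthoBasis g' x V i) (orthoBasis g' x V i) =
      c⁻¹ • ∑ i, B (orthoBasis g x V i) (orthoBasis g x V i) := by
  -- Both traces become double sums over mixed terms: expanding the `g`-basis in the `g'`-basis has
  -- coefficients `c * g(e_j, e'_i)`, the reverse expansion has `g(e_j, e'_i)`. They differ by the
  -- factor `c`.
  have h1 : ∑ j, B (orthoBasis g x V j) (orthoBasis g x V j) =
      ∑ j, ∑ i, (c * g.inner x (orthoBasis g x V j) (orthoBasis g' x V i)) •
        B (orthoBasis g' x V i) (orthoBasis g x V j) := by
    refine Finset.sum_congr rfl fun j _ => ?_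
    have := sum_inner_smul_orthoBasis g' (orthoBasis_mem g V j)
    conv_lhs =>
      arg 1
      rw [← this]
    simp only [map_sum, map_smul, LinearMap.sum_apply, LinearMap.smul_apply]
    refine Finset.sum_congr rfl fun i _ => ?_
    rw [h _ (orthoBasis_mem g V j) _ (orthoBasis_mem g' V i)]
  have h2 : ∑ i, B (orthoBasis g' x V i) (orthoBasis g' x V i) =
      ∑ i, ∑ j, (g.inner x (orthoBasis g x V j) (orthoBasis g' x V i)) •
        B (orthoBasis g' x V i) (orthoBasis g x V j) := by
    refine Finset.sum_congr rfl fun i _ => ?_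
    have := sum_inner_smul_orthoBasis g (orthoBasis_mem g' V i)
    conv_lhs =>
      arg 2
      rw [← this]
    simp only [map_sum, map_smul]
    refine Finset.sum_congr rfl fun j _ => ?_
    rw [g.symm]
  rw [h1, h2, Finset.sum_comm, Finset.smul_sum]
  refine Finset.sum_congr rfl fun j _ => ?_
  rw [Finset.smul_sum]
  refine Finset.sum_congr rfl fun i _ => ?_
  rw [← mul_smul, inv_mul_cancel_left₀ hc]

/-- The squared norm of a bilinear map over a subspace on which two metrics are proportional. -/
theorem sum_sum_orthoBasis_of_conformal
    {V : Submodule ℝ (TangentSpace (𝓡 (n + p)) x)} {c : ℝ} (hc : c ≠ 0)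
    (h : ∀ v ∈ V, ∀ w ∈ V, g'.inner x v w = c * g.inner x v w)
    {B : TangentSpace (𝓡 (n + p)) x → TangentSpace (𝓡 (n + p)) x → TangentSpace (𝓡 (n + p)) x}
    (hB : IsBilinearMap ℝ B) (m : Metric n p M) :
    ∑ i, ∑ j, m.inner x (B (orthoBasis g' x V i) (orthoBasis g' x V j))
        (B (orthoBasis g' x V i) (orthoBasis g' x V j)) =
      (c ^ 2)⁻¹ * ∑ i, ∑ j, m.inner x (B (orthoBasis g x V i) (orthoBasis g x V j))
        (B (orthoBasis g x V i) (orthoBasis g x V j)) := by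
  let L (u w : TangentSpace (𝓡 (n + p)) x) :
      TangentSpace (𝓡 (n + p)) x →ₗ[ℝ] TangentSpace (𝓡 (n + p)) x →ₗ[ℝ] ℝ :=
    LinearMap.mk₂ ℝ (fun v z => m.inner x (B u v) (B w z))
      (by simp [hB.add_right]) (by simp [hB.smul_right]) (by simp [hB.add_right])
      (by simp [hB.smul_right])
  let R (u w : TangentSpace (𝓡 (n + p)) x) :
      TangentSpace (𝓡 (n + p)) x →ₗ[ℝ] TangentSpace (𝓡 (n + p)) x →ₗ[ℝ] ℝ :=
    LinearMap.mk₂ ℝ (fun v z => m.inner x (B v u) (B z w))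
      (by simp [hB.add_left]) (by simp [hB.smul_left]) (by simp [hB.add_left])
      (by simp [hB.smul_left])
  have h1 : ∀ u, ∑ j, m.inner x (B u (orthoBasis g' x V j)) (B u (orthoBasis g' x V j)) =
      c⁻¹ * ∑ j, m.inner x (B u (orthoBasis g x V j)) (B u (orthoBasis g x V j)) := fun u =>
    sum_orthoBasis_of_conformal g g' hc h (L u u)
  have h2 : ∀ u, ∑ j, m.inner x (B (orthoBasis g' x V j) u) (B (orthoBasis g' x V j) u) =
      c⁻¹ * ∑ j, m.inner x (B (orthoBasis g x V j) u) (B (orthoBasis g x V j) u) := fun u =>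
    sum_orthoBasis_of_conformal g g' hc h (R u u)
  simp only [h1]
  rw [← Finset.mul_sum, Finset.sum_comm]
  simp only [h2]
  rw [← Finset.mul_sum, Finset.sum_comm, ← mul_assoc, sq, mul_inv]

end FiberAlgebra

/-! ### The two projections and adapted metrics -/

section Projections

variable {n p : ℕ} {M : Type*} [TopologicalSpace M] [ChartedSpace (Model n p) M]
  [IsManifold (𝓡 (n + p)) ∞ M] {F : Foliation n p M} (D : TransversalDistribution F) {x : M}

theorem TransversalDistribution.perp_mem (v : TangentSpace (𝓡 (n + p)) x) :
    D.perp x v ∈ D.carrier x :=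
  Submodule.projection_apply_mem _ v

theorem TransversalDistribution.tang_mem (v : TangentSpace (𝓡 (n + p)) x) :
    D.tang x v ∈ F.tangent x :=
  Submodule.projection_apply_mem _ v

theorem TransversalDistribution.perp_add_tang (v : TangentSpace (𝓡 (n + p)) x) :
    D.perp x v + D.tang x v = v :=
  Submodule.projection_add_projection_eq_self _ v

theorem TransversalDistribution.perp_of_mem {v : TangentSpace (𝓡 (n + p)) x}
    (hv : v ∈ D.carrier x) : D.perp x v = v :=
  Submodule.projection_apply_of_mem_left (D.isCompl x) hv

theorem TransversalDistribution.tang_of_mem {v : TangentSpace (𝓡 (n + p)) x}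
    (hv : v ∈ F.tangent x) : D.tang x v = v :=
  Submodule.projection_apply_of_mem_left (D.isCompl x).symm hv

theorem TransversalDistribution.perp_of_mem_tangent {v : TangentSpace (𝓡 (n + p)) x}
    (hv : v ∈ F.tangent x) : D.perp x v = 0 :=
  Submodule.projection_apply_of_mem_right (D.isCompl x) hv

theorem TransversalDistribution.tang_of_mem_carrier {v : TangentSpace (𝓡 (n + p)) x}
    (hv : v ∈ D.carrier x) : D.tang x v = 0 :=
  Submodule.projection_apply_of_mem_right (D.isCompl x).symm hv

theorem TransversalDistribution.perp_perp (v : TangentSpace (𝓡 (n + p)) x) :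
    D.perp x (D.perp x v) = D.perp x v :=
  D.perp_of_mem (D.perp_mem v)

theorem TransversalDistribution.tang_tang (v : TangentSpace (𝓡 (n + p)) x) :
    D.tang x (D.tang x v) = D.tang x v :=
  D.tang_of_mem (D.tang_mem v)

@[simp]
theorem TransversalDistribution.perpExtend_self (v : TangentSpace (𝓡 (n + p)) x) :
    D.perpExtend v x = D.perp x v := by
  simp [TransversalDistribution.perpExtend]

@[simp]
theorem TransversalDistribution.tangExtend_self (v : TangentSpace (𝓡 (n + p)) x) :
    D.tangExtend v x = D.tang x v := by
  simp [TransversalDistribution.tangExtend]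

variable {D} {g : Metric n p M}

theorem IsAdapted.inner_tang (hg : IsAdapted g D) {w : TangentSpace (𝓡 (n + p)) x}
    (hw : w ∈ F.tangent x) (v : TangentSpace (𝓡 (n + p)) x) :
    g.inner x (D.tang x v) w = g.inner x v w := by
  conv_rhs => rw [← D.perp_add_tang v]
  simp [hg x _ (D.perp_mem v) w hw]

theorem IsAdapted.inner_perp (hg : IsAdapted g D) {w : TangentSpace (𝓡 (n + p)) x}
    (hw : w ∈ D.carrier x) (v : TangentSpace (𝓡 (n + p)) x) :
    g.inner x (D.perp x v) w = g.inner x v w := by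
  conv_rhs => rw [← D.perp_add_tang v]
  simp [g.symm x (D.tang x v) w, hg x w hw _ (D.tang_mem v)]

end Projections

/-! ### Koszul expression and Lie derivative of the metric as tensors -/

section Calculus

variable {n p : ℕ} {M : Type*} [TopologicalSpace M] [ChartedSpace (Model n p) M]
  [IsManifold (𝓡 (n + p)) ∞ M] (g : Metric n p M) {x : M}
  {X Y Z : (x : M) → TangentSpace (𝓡 (n + p)) x}

/-- Differentiability of a vector field at a point. -/
abbrev DiffField (X : (x : M) → TangentSpace (𝓡 (n + p)) x) (x : M) : Prop :=
  MDifferentiableAt (𝓡 (n + p)) (𝓡 (n + p)).tangent (T% X) x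

/-- Smoothness of a vector field at a point. -/
abbrev SmoothField (X : (x : M) → TangentSpace (𝓡 (n + p)) x) (x : M) : Prop :=
  ContMDiffAt (𝓡 (n + p)) (𝓡 (n + p)).tangent ∞ (T% X) x

theorem contMDiffAt_inner {m : WithTop ℕ∞} (hm : m ≤ ∞)
    (hX : ContMDiffAt (𝓡 (n + p)) (𝓡 (n + p)).tangent m (T% X) x) (hY : ContMDiffAt (𝓡 (n + p)) (𝓡 (n + p)).tangent m (T% Y) x) :
    ContMDiffAt (𝓡 (n + p)) 𝓘(ℝ, ℝ) m (fun y => g.inner y (X y) (Y y)) x := by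
  have : ContMDiffAt (𝓡 (n + p)) ((𝓡 (n + p)).prod 𝓘(ℝ)) m
      (fun y ↦ TotalSpace.mk' ℝ (E := Bundle.Trivial M ℝ) y (g.inner y (X y) (Y y))) x := by
    apply ContMDiffAt.clm_bundle_apply₂ (F₁ := Model n p) (F₂ := Model n p)
    · exact (g.contMDiff x).of_le hm
    · exact hX
    · exact hY
  simp only [contMDiffAt_totalSpace] at this
  exact this.2

theorem mdifferentiableAt_inner (hX : DiffField X x) (hY : DiffField Y x) :
    MDifferentiableAt (𝓡 (n + p)) 𝓘(ℝ, ℝ) (fun y => g.inner y (X y) (Y y)) x := by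
  have : MDifferentiableAt (𝓡 (n + p)) ((𝓡 (n + p)).prod 𝓘(ℝ))
      (fun y ↦ TotalSpace.mk' ℝ (E := Bundle.Trivial M ℝ) y (g.inner y (X y) (Y y))) x := by
    apply MDifferentiableAt.clm_bundle_apply₂ (F₁ := Model n p) (F₂ := Model n p)
    · exact (g.contMDiff x).mdifferentiableAt (by simp)
    · exact hX
    · exact hY
  simp only [mdifferentiableAt_totalSpace] at this
  exact this.2

/-- A fibrewise linear operator which preserves smoothness of vector fields preserves their
differentiability. -/
theorem mdifferentiableAt_of_preserves_smooth
    (P : (y : M) → TangentSpace (𝓡 (n + p)) y →ₗ[ℝ] TangentSpace (𝓡 (n + p)) y)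
    (hP : ∀ X : (y : M) → TangentSpace (𝓡 (n + p)) y, SmoothField X x →
      SmoothField (fun y => P y (X y)) x)
    (hX : DiffField X x) : DiffField (fun y => P y (X y)) x := by
  -- In a smooth local frame the operator acts on smooth frame fields, and only the coefficients of
  -- `X` are merely differentiable.
  let t := trivializationAt (Model n p) (TangentSpace (𝓡 (n + p)) : M → Type _) x
  have x_mem : x ∈ t.baseSet := FiberBundle.mem_baseSet_trivializationAt _ _ x
  let b := Module.finBasis ℝ (Model n p)
  let s := t.localFrame b
  let c := t.localFrameCoeff (𝓡 (n + p)) b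
  have hs (i) : SmoothField (s i) x := contMDiffAt_localFrame_of_mem ∞ _ b i x_mem
  have hc (i) : MDifferentiableAt (𝓡 (n + p)) 𝓘(ℝ, ℝ) (LinearMap.piApply (c i) X) x :=
    mdifferentiableAt_localFrameCoeff b x_mem hX i
  have key : DiffField (fun y => ∑ i, c i y (X y) • P y (s i y)) x :=
    MDifferentiableAt.sum_section fun i _ => (hc i).smul_section
      ((hP _ (hs i)).mdifferentiableAt (by simp))
  refine key.congr_of_eventuallyEq ?_
  filter_upwards [t.eventually_eq_localFrame_sum_coeff_smul (I := 𝓡 (n + p)) b x_mem (s := X)]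
    with y hy
  congr 1
  conv_lhs => rw [hy]
  simp only [map_sum, map_smul]
  rfl

variable {F : Foliation n p M} (D : TransversalDistribution F)

theorem contMDiffAt_perp (hX : SmoothField X x) :
    SmoothField (fun y => D.perp y (X y)) x :=
  D.contMDiffAt_projection X x hX

theorem contMDiffAt_tang (hX : SmoothField X x) :
    SmoothField (fun y => D.tang y (X y)) x := by
  have : (fun y => D.tang y (X y)) = X - fun y => D.perp y (X y) := by
    ext1 y
    rw [Pi.sub_apply, eq_sub_iff_add_eq', D.perp_add_tang]
  rw [this]
  exact hX.sub_section (contMDiffAt_perp D hX)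

theorem mdifferentiableAt_perp (hX : DiffField X x) :
    DiffField (fun y => D.perp y (X y)) x :=
  mdifferentiableAt_of_preserves_smooth D.perp (fun _ h => contMDiffAt_perp D h) hX

theorem mdifferentiableAt_tang (hX : DiffField X x) :
    DiffField (fun y => D.tang y (X y)) x :=
  mdifferentiableAt_of_preserves_smooth D.tang (fun _ h => contMDiffAt_tang D h) hX

theorem mdifferentiableAt_extend (v : TangentSpace (𝓡 (n + p)) x) :
    DiffField (FiberBundle.extend (Model n p) v) x :=
  FiberBundle.mdifferentiableAt_extend ..

theorem mdifferentiableAt_perpExtend (v : TangentSpace (𝓡 (n + p)) x) :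
    DiffField (D.perpExtend v) x :=
  mdifferentiableAt_perp D (mdifferentiableAt_extend v)

theorem mdifferentiableAt_tangExtend (v : TangentSpace (𝓡 (n + p)) x) :
    DiffField (D.tangExtend v) x :=
  mdifferentiableAt_tang D (mdifferentiableAt_extend v)

/-- The Koszul expression is tensorial in its last argument. -/
theorem tensorialAt_koszul (hX : DiffField X x) (hY : DiffField Y x) :
    TensorialAt (𝓡 (n + p)) (Model n p) (fun Z => koszul g X Y Z x) x where
  smul {f Z} hf hZ := by
    have h1 : mvfderiv (𝓡 (n + p)) (fun y => g.inner y (Y y) ((f • Z) y)) x (X x) =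
        f x * mvfderiv (𝓡 (n + p)) (fun y => g.inner y (Y y) (Z y)) x (X x) +
        g.inner x (Y x) (Z x) * mvfderiv (𝓡 (n + p)) f x (X x) := by
      simp [mvfderiv_fun_mul hf (mdifferentiableAt_inner g hY hZ)]
    have h2 : mvfderiv (𝓡 (n + p)) (fun y => g.inner y (X y) ((f • Z) y)) x (Y x) =
        f x * mvfderiv (𝓡 (n + p)) (fun y => g.inner y (X y) (Z y)) x (Y x) +
        g.inner x (X x) (Z x) * mvfderiv (𝓡 (n + p)) f x (Y x) := by
      simp [mvfderiv_fun_mul hf (mdifferentiableAt_inner g hX hZ)]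
    simp only [koszul, h1, h2, VectorField.mlieBracket_smul_right hf hZ]
    simp [g.symm x (Z x)]
    ring
  add {Z Z'} hZ hZ' := by
    have h1 : mvfderiv (𝓡 (n + p)) (fun y => g.inner y (Y y) ((Z + Z') y)) x (X x) =
        mvfderiv (𝓡 (n + p)) (fun y => g.inner y (Y y) (Z y)) x (X x) +
        mvfderiv (𝓡 (n + p)) (fun y => g.inner y (Y y) (Z' y)) x (X x) := by
      simp [mvfderiv_fun_add (mdifferentiableAt_inner g hY hZ) (mdifferentiableAt_inner g hY hZ')]
    have h2 : mvfderiv (𝓡 (n + p)) (fun y => g.inner y (X y) ((Z + Z') y)) x (Y x) =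
        mvfderiv (𝓡 (n + p)) (fun y => g.inner y (X y) (Z y)) x (Y x) +
        mvfderiv (𝓡 (n + p)) (fun y => g.inner y (X y) (Z' y)) x (Y x) := by
      simp [mvfderiv_fun_add (mdifferentiableAt_inner g hX hZ) (mdifferentiableAt_inner g hX hZ')]
    simp only [koszul, h1, h2, VectorField.mlieBracket_add_right hZ hZ']
    simp
    ring

theorem inner_leviCivita (hX : DiffField X x) (hY : DiffField Y x) (hZ : DiffField Z x) :
    g.inner x (leviCivita g X Y x) (Z x) = (1 / 2 : ℝ) * koszul g X Y Z x := by
  have hT := tensorialAt_koszul g hX hY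
  rw [← hT.mkHom_apply hZ]
  conv_rhs => rw [← sum_inner_smul_orthoBasis g (Submodule.mem_top (x := Z x))]
  simp only [leviCivita, map_sum, map_smul, sum_apply,
    smul_apply, smul_eq_mul, Finset.mul_sum]
  refine Finset.sum_congr rfl fun i _ => ?_
  rw [hT.mkHom_apply_eq_extend, g.symm]
  ring

/-- The Lie derivative `(ℒ_Z g)(X, Y)` of the metric. -/
def lieMetric (Z X Y : (x : M) → TangentSpace (𝓡 (n + p)) x) (x : M) : ℝ :=
  mvfderiv (𝓡 (n + p)) (fun y => g.inner y (X y) (Y y)) x (Z x)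
  + g.inner x (VectorField.mlieBracket (𝓡 (n + p)) X Z x) (Y x)
  + g.inner x (VectorField.mlieBracket (𝓡 (n + p)) Y Z x) (X x)

theorem lieMetric_comm (Z X Y : (x : M) → TangentSpace (𝓡 (n + p)) x) (x : M) :
    lieMetric g Z X Y x = lieMetric g Z Y X x := by
  simp only [lieMetric, g.symm _ (X _) (Y _)]
  ring

theorem tensorialAt_lieMetric_left (Z) (hY : DiffField Y x) :
    TensorialAt (𝓡 (n + p)) (Model n p) (fun X => lieMetric g Z X Y x) x where
  smul {f X} hf hX := by
    have h1 : mvfderiv (𝓡 (n + p)) (fun y => g.inner y ((f • X) y) (Y y)) x (Z x) =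
        f x * mvfderiv (𝓡 (n + p)) (fun y => g.inner y (X y) (Y y)) x (Z x) +
        g.inner x (X x) (Y x) * mvfderiv (𝓡 (n + p)) f x (Z x) := by
      simp [mvfderiv_fun_mul hf (mdifferentiableAt_inner g hX hY)]
    simp only [lieMetric, h1, VectorField.mlieBracket_smul_left hf hX]
    simp
    ring
  add {X X'} hX hX' := by
    have h1 : mvfderiv (𝓡 (n + p)) (fun y => g.inner y ((X + X') y) (Y y)) x (Z x) =
        mvfderiv (𝓡 (n + p)) (fun y => g.inner y (X y) (Y y)) x (Z x) +
        mvfderiv (𝓡 (n + p)) (fun y => g.inner y (X' y) (Y y)) x (Z x) := by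
      simp [mvfderiv_fun_add (mdifferentiableAt_inner g hX hY) (mdifferentiableAt_inner g hX' hY)]
    simp only [lieMetric, h1, VectorField.mlieBracket_add_left hX hX']
    simp
    ring

theorem tensorialAt_lieMetric_right (Z) (hX : DiffField X x) :
    TensorialAt (𝓡 (n + p)) (Model n p) (fun Y => lieMetric g Z X Y x) x := by
  simp only [lieMetric_comm g Z X]
  exact tensorialAt_lieMetric_left g Z hX

/-- The Lie derivative of the metric as a bilinear form on the tangent space. -/
def lieMetricForm (Z : (x : M) → TangentSpace (𝓡 (n + p)) x) (x : M) :
    TangentSpace (𝓡 (n + p)) x →L[ℝ] TangentSpace (𝓡 (n + p)) x →L[ℝ] ℝ :=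
  TensorialAt.mkHom₂ (fun X Y => lieMetric g Z X Y x) x
    (fun _ h => tensorialAt_lieMetric_left g Z h) (fun _ h => tensorialAt_lieMetric_right g Z h)

theorem lieMetricForm_apply (Z) (hX : DiffField X x) (hY : DiffField Y x) :
    lieMetricForm g Z x (X x) (Y x) = lieMetric g Z X Y x :=
  TensorialAt.mkHom₂_apply _ _ hX hY

end Calculus

/-! ### Derivatives and brackets in a vector space -/

section VectorSpace

/-- A linear functional vanishing on `W` but not on the derivative would have a locally zero
composite with `f`. If `f` is not differentiable, `fderiv` is zero by convention. -/
theorem fderiv_mem_of_eventually_mem {E E' : Type*} [NormedAddCommGroup E] [NormedSpace ℝ E]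
    [NormedAddCommGroup E'] [NormedSpace ℝ E'] [FiniteDimensional ℝ E'] {W : Submodule ℝ E'}
    {f : E → E'} {z : E}
    (h : ∀ᶠ y in nhds z, f y ∈ W) (v : E) : fderiv ℝ f z v ∈ W := by
  by_cases hf : DifferentiableAt ℝ f z
  · by_contra hv
    obtain ⟨l, hl, hW⟩ := Submodule.exists_dual_map_eq_bot_of_notMem hv inferInstance
    let l' : E' →L[ℝ] ℝ := l.toContinuousLinearMap
    have h0 : (l' ∘ f) =ᶠ[nhds z] fun _ => 0 := by
      filter_upwards [h] with y hy
      have : l (f y) ∈ W.map l := Submodule.mem_map_of_mem hy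
      rw [hW] at this
      exact this
    have h1 : HasFDerivAt (l' ∘ f) (l'.comp (fderiv ℝ f z)) z :=
      l'.hasFDerivAt.comp z hf.hasFDerivAt
    have h2 := h1.fderiv.symm.trans h0.fderiv_eq
    have h3 := congrArg (fun A => A v) h2
    simp only [ContinuousLinearMap.comp_apply, fderiv_fun_const] at h3
    exact hl h3
  · simp [fderiv_zero_of_not_differentiableAt hf]

theorem mlieBracket_eq_lieBracket {E : Type*} [NormedAddCommGroup E] [NormedSpace ℝ E]
    (V V' : (z : E) → TangentSpace 𝓘(ℝ, E) z) (z : E) :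
    VectorField.mlieBracket 𝓘(ℝ, E) V V' z = VectorField.lieBracket ℝ V V' z := by
  rw [← VectorField.mlieBracketWithin_univ]
  exact (congrFun (VectorField.mlieBracketWithin_eq_lieBracketWithin (V := V) (W := V')) z).trans
    (congrFun VectorField.lieBracketWithin_univ z)

end VectorSpace

/-! ### Flat charts and the rank of the foliation -/

section FlatCharts

variable {n p : ℕ} {M : Type*} [TopologicalSpace M] [ChartedSpace (Model n p) M]

theorem flatChart_mdifferentiable {φ : OpenPartialHomeomorph M (Model n p)}
    (h : φ ∈ IsManifold.maximalAtlas (𝓡 (n + p)) ∞ M) :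
    φ.MDifferentiable (𝓡 (n + p)) (𝓡 (n + p)) :=
  ⟨(contMDiffOn_of_mem_maximalAtlas h).mdifferentiableOn (by simp),
    (contMDiffOn_symm_of_mem_maximalAtlas h).mdifferentiableOn (by simp)⟩

/-- Translates pullback of fields, for which brackets are natural, into the differential of `φ`, in
which flatness is phrased. -/
theorem mpullback_symm_eq_mvfderiv {φ : OpenPartialHomeomorph M (Model n p)}
    (h : φ ∈ IsManifold.maximalAtlas (𝓡 (n + p)) ∞ M) (V : (x : M) → TangentSpace (𝓡 (n + p)) x)
    {z : Model n p} (hz : z ∈ φ.target) :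
    VectorField.mpullback (𝓡 (n + p)) (𝓡 (n + p)) φ.symm V z =
      mvfderiv (𝓡 (n + p)) φ (φ.symm z) (V (φ.symm z)) := by
  have h1 := ContinuousLinearMap.inverse_equiv ((flatChart_mdifferentiable h).symm.mfderiv hz)
  exact congrArg (fun A => A (V (φ.symm z))) h1

theorem Foliation.finrank_tangent (F : Foliation n p M) (x : M) :
    Module.finrank ℝ (F.tangent x) = p := by
  obtain ⟨φ, W, hx, hφ, -, hp, hW⟩ := F.exists_flatChart x
  let e : TangentSpace (𝓡 (n + p)) x ≃ₗ[ℝ] Model n p :=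
    ((flatChart_mdifferentiable hφ).mfderiv hx).toLinearEquiv
  have : (F.tangent x).map (e : TangentSpace (𝓡 (n + p)) x →ₗ[ℝ] Model n p) = W := by
    ext w
    rw [Submodule.mem_map]
    constructor
    · rintro ⟨v, hv, rfl⟩
      exact (hW x hx v).1 hv
    · intro hw
      refine ⟨e.symm w, (hW x hx _).2 ?_, e.apply_symm_apply w⟩
      convert hw
      exact e.apply_symm_apply w
  exact (LinearEquiv.finrank_map_eq e (F.tangent x)).symm.trans
    ((congrArg (fun V : Submodule ℝ (Model n p) => Module.finrank ℝ V) this).trans hp)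

end FlatCharts

/-! ### Involutivity of the foliation and the rank of the complement -/

section Frobenius

variable {n p : ℕ} {M : Type*} [TopologicalSpace M] [ChartedSpace (Model n p) M]
  [IsManifold (𝓡 (n + p)) ∞ M] {x : M}
  {X Y Z : (x : M) → TangentSpace (𝓡 (n + p)) x}

/-- In a flat chart both fields take values in the fixed subspace `W`, so their directional
derivatives, and hence the bracket, do too. -/
theorem Foliation.mlieBracket_mem (F : Foliation n p M) (hX : DiffField X x) (hY : DiffField Y x)
    (hXF : ∀ y, X y ∈ F.tangent y) (hYF : ∀ y, Y y ∈ F.tangent y) :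
    VectorField.mlieBracket (𝓡 (n + p)) X Y x ∈ F.tangent x := by
  obtain ⟨φ, W, hx, hφ, -, -, hW⟩ := F.exists_flatChart x
  obtain ⟨z, hz, rfl⟩ : ∃ z ∈ φ.target, φ.symm z = x := ⟨φ x, φ.map_source hx, φ.left_inv hx⟩
  have key : ∀ V : (x : M) → TangentSpace (𝓡 (n + p)) x, (∀ y, V y ∈ F.tangent y) →
      ∀ᶠ z' in nhds z,
        (VectorField.mpullback (𝓡 (n + p)) (𝓡 (n + p)) φ.symm V z' : Model n p) ∈ W := by
    intro V hV
    filter_upwards [φ.open_target.mem_nhds hz] with z' hz'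
    rw [mpullback_symm_eq_mvfderiv hφ V hz']
    exact (hW _ (φ.map_target hz') _).1 (hV (φ.symm z'))
  have : IsManifold (𝓡 (n + p)) (minSmoothness ℝ 2) M := by
    rw [minSmoothness_of_isRCLikeNormedField]
    exact IsManifold.of_le (n := ∞) ENat.LEInfty.out
  refine (hW _ hx _).2 ?_
  rw [← mpullback_symm_eq_mvfderiv hφ _ hz, VectorField.mpullback_mlieBracket (n := ∞) hX hY
    ((contMDiffOn_symm_of_mem_maximalAtlas hφ).contMDiffAt (φ.open_target.mem_nhds hz))
    (by rw [minSmoothness_of_isRCLikeNormedField]; exact ENat.LEInfty.out)]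
  refine (congrArg (· ∈ W) (mlieBracket_eq_lieBracket _ _ z)).mpr ?_
  exact sub_mem (fderiv_mem_of_eventually_mem (key Y hYF) _)
    (fderiv_mem_of_eventually_mem (key X hXF) _)

/-- Supplies the value `n` for the trace of `g` over `𝒟`. -/
theorem TransversalDistribution.finrank_carrier {F : Foliation n p M}
    (D : TransversalDistribution F) (x : M) : Module.finrank ℝ (D.carrier x) = n := by
  have h := Submodule.finrank_add_eq_of_isCompl (D.isCompl x)
  have h' : Module.finrank ℝ (TangentSpace (𝓡 (n + p)) x) = n + p :=
    (finrank_euclideanSpace_fin : Module.finrank ℝ (Model n p) = n + p)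
  rw [F.finrank_tangent, h'] at h
  omega

end Frobenius

/-! ### Extrinsic tensors through Lie derivatives of the metric -/

section ExtrinsicGeometry

variable {n p : ℕ} {M : Type*} [TopologicalSpace M] [ChartedSpace (Model n p) M]
  [IsManifold (𝓡 (n + p)) ∞ M] {x : M}
  {X Y Z : (x : M) → TangentSpace (𝓡 (n + p)) x}
  {F : Foliation n p M} {D : TransversalDistribution F} {g : Metric n p M}

theorem mvfderiv_inner_of_adapted (hg : IsAdapted g D) (hX : ∀ y, X y ∈ D.carrier y)
    (hY : ∀ y, Y y ∈ F.tangent y) :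
    mvfderiv (𝓡 (n + p)) (fun y => g.inner y (X y) (Y y)) x = 0 := by
  have : (fun y => g.inner y (X y) (Y y)) = fun _ => 0 := funext fun y => hg y _ (hX y) _ (hY y)
  rw [this]
  simp [mvfderiv]

theorem IsAdapted.symm_inner (hg : IsAdapted g D) {v w : TangentSpace (𝓡 (n + p)) x}
    (hv : v ∈ F.tangent x) (hw : w ∈ D.carrier x) : g.inner x v w = 0 := by
  rw [g.symm]
  exact hg x w hw v hv

/-- The functions `g(X,Z)` and `g(Y,Z)` vanish identically and the `[X,Y]` terms cancel by
antisymmetry. -/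
theorem koszul_add_koszul_swap (hg : IsAdapted g D) (hX : ∀ y, X y ∈ D.carrier y)
    (hY : ∀ y, Y y ∈ D.carrier y) (hZ : ∀ y, Z y ∈ F.tangent y) :
    koszul g X Y Z x + koszul g Y X Z x = -2 * lieMetric g Z X Y x := by
  simp only [koszul, lieMetric, mvfderiv_inner_of_adapted hg hX hZ,
    mvfderiv_inner_of_adapted hg hY hZ, VectorField.mlieBracket_swap_apply (V := Y) (W := X),
    g.symm _ (Y _) (X _)]
  simp
  ring

/-- No symmetrization is needed: by involutivity `[X,Y]` is tangent to the leaves, hence orthogonal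
to `Z`. -/
theorem koszul_of_tangent (hg : IsAdapted g D) (hX : ∀ y, X y ∈ F.tangent y)
    (hY : ∀ y, Y y ∈ F.tangent y) (hZ : ∀ y, Z y ∈ D.carrier y) (hdX : DiffField X x)
    (hdY : DiffField Y x) :
    koszul g X Y Z x = - lieMetric g Z X Y x := by
  have h : ∀ {V : (x : M) → TangentSpace (𝓡 (n + p)) x}, (∀ y, V y ∈ F.tangent y) →
      mvfderiv (𝓡 (n + p)) (fun y => g.inner y (V y) (Z y)) x = 0 := by
    intro V hV
    simp only [g.symm _ (V _) (Z _)]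
    exact mvfderiv_inner_of_adapted hg hZ hV
  simp only [koszul, lieMetric, h hX, h hY,
    hg.symm_inner (F.mlieBracket_mem hdX hdY hX hY) (hZ x)]
  simp
  ring

theorem koszul_self (X Y : (x : M) → TangentSpace (𝓡 (n + p)) x) :
    koszul g X Y X x = lieMetric g Y X X x := by
  simp only [koszul, lieMetric, VectorField.mlieBracket_swap_apply (V := Y) (W := X),
    g.symm _ (Y _) (X _), VectorField.mlieBracket_self]
  simp

/-- This form shows both the bilinearity of `h` and its dependence on the metric. -/
theorem inner_secondFund (hg : IsAdapted g D) (v w : TangentSpace (𝓡 (n + p)) x)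
    {z : TangentSpace (𝓡 (n + p)) x} (hz : z ∈ F.tangent x) :
    g.inner x (secondFund g D x v w) z =
      -(1 / 2 : ℝ) * lieMetricForm g (D.tangExtend z) x (D.perp x v) (D.perp x w) := by
  have hv := mdifferentiableAt_perpExtend D v
  have hw := mdifferentiableAt_perpExtend D w
  have hz' := mdifferentiableAt_tangExtend D z
  have hL := lieMetricForm_apply g (D.tangExtend z) hv hw
  rw [D.perpExtend_self, D.perpExtend_self] at hL
  have hk := koszul_add_koszul_swap (x := x) hg (X := D.perpExtend v) (Y := D.perpExtend w)
    (Z := D.tangExtend z) (fun y => D.perp_mem _) (fun y => D.perp_mem _) (fun y => D.tang_mem _)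
  have h1 := inner_leviCivita g hv hw hz'
  have h2 := inner_leviCivita g hw hv hz'
  rw [D.tangExtend_self, D.tang_of_mem hz] at h1 h2
  rw [hL, secondFund, map_smul, smul_apply, hg.inner_tang hz, map_add,
    add_apply, h1, h2, smul_eq_mul]
  linear_combination (1 / 4 : ℝ) * hk

theorem secondFund_mem (v w : TangentSpace (𝓡 (n + p)) x) :
    secondFund g D x v w ∈ F.tangent x :=
  Submodule.smul_mem _ _ (D.tang_mem _)

theorem isBilinearMap_secondFund (hg : IsAdapted g D) :
    IsBilinearMap ℝ (secondFund g D x) where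
  add_left u v w := by
    refine eq_of_inner_eq g (secondFund_mem _ _)
      (add_mem (secondFund_mem _ _) (secondFund_mem _ _)) fun z hz => ?_
    simp only [map_add, add_apply, inner_secondFund hg _ _ hz]
    ring
  smul_left c u v := by
    refine eq_of_inner_eq g (secondFund_mem _ _)
      (Submodule.smul_mem _ _ (secondFund_mem _ _)) fun z hz => ?_
    simp only [map_smul, smul_apply, inner_secondFund hg _ _ hz, smul_eq_mul]
    ring
  add_right u v w := by
    refine eq_of_inner_eq g (secondFund_mem _ _)
      (add_mem (secondFund_mem _ _) (secondFund_mem _ _)) fun z hz => ?_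
    simp only [map_add, add_apply, inner_secondFund hg _ _ hz]
    ring
  smul_right c u v := by
    refine eq_of_inner_eq g (secondFund_mem _ _)
      (Submodule.smul_mem _ _ (secondFund_mem _ _)) fun z hz => ?_
    simp only [map_smul, smul_apply, inner_secondFund hg _ _ hz, smul_eq_mul]
    ring

theorem inner_perp_leviCivita (hg : IsAdapted g D) (hX : DiffField X x) (hY : DiffField Y x)
    {z : TangentSpace (𝓡 (n + p)) x} (hz : z ∈ D.carrier x) :
    g.inner x (D.perp x (leviCivita g (fun y => D.tang y (X y)) (fun y => D.tang y (Y y)) x)) z =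
      -(1 / 2 : ℝ) * lieMetricForm g (D.perpExtend z) x (D.tang x (X x)) (D.tang x (Y x)) := by
  have hX' := mdifferentiableAt_tang D hX
  have hY' := mdifferentiableAt_tang D hY
  have h1 := inner_leviCivita g hX' hY' (mdifferentiableAt_perpExtend D z)
  rw [D.perpExtend_self, D.perp_of_mem hz] at h1
  rw [hg.inner_perp hz, h1, lieMetricForm_apply g (D.perpExtend z) hX' hY',
    koszul_of_tangent (Z := D.perpExtend z) hg (fun y => D.tang_mem _) (fun y => D.tang_mem _)
      (fun y => D.perp_mem _) hX' hY']
  ring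

theorem inner_leafSecondFund (hg : IsAdapted g D) (v w : TangentSpace (𝓡 (n + p)) x)
    {z : TangentSpace (𝓡 (n + p)) x} (hz : z ∈ D.carrier x) :
    g.inner x (leafSecondFund g D x v w) z =
      -(1 / 2 : ℝ) * lieMetricForm g (D.perpExtend z) x (D.tang x v) (D.tang x w) := by
  have := inner_perp_leviCivita hg (mdifferentiableAt_extend v) (mdifferentiableAt_extend w) hz
  rwa [FiberBundle.extend_apply_self, FiberBundle.extend_apply_self] at this

theorem leafSecondFund_mem (v w : TangentSpace (𝓡 (n + p)) x) :
    leafSecondFund g D x v w ∈ D.carrier x :=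
  D.perp_mem _

/-- The definition extends vectors anew at each base point. Replacing those extensions by fixed
fields makes it possible to differentiate `h_𝓕` in the base point. -/
theorem leafSecondFund_eq (hg : IsAdapted g D) (hX : DiffField X x) (hY : DiffField Y x) :
    leafSecondFund g D x (X x) (Y x) =
      D.perp x (leviCivita g (fun y => D.tang y (X y)) (fun y => D.tang y (Y y)) x) :=
  eq_of_inner_eq g (leafSecondFund_mem _ _) (D.perp_mem _) fun z hz => by
    rw [inner_leafSecondFund hg _ _ hz, inner_perp_leviCivita hg hX hY hz]

theorem leafSecondFund_tang (hg : IsAdapted g D) (v w : TangentSpace (𝓡 (n + p)) x) :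
    leafSecondFund g D x (D.tang x v) (D.tang x w) = leafSecondFund g D x v w :=
  eq_of_inner_eq g (leafSecondFund_mem _ _) (leafSecondFund_mem _ _) fun z hz => by
    simp only [inner_leafSecondFund hg _ _ hz, D.tang_tang]

theorem isBilinearMap_leafSecondFund (hg : IsAdapted g D) :
    IsBilinearMap ℝ (leafSecondFund g D x) where
  add_left u v w := by
    refine eq_of_inner_eq g (leafSecondFund_mem _ _)
      (add_mem (leafSecondFund_mem _ _) (leafSecondFund_mem _ _)) fun z hz => ?_
    simp only [map_add, add_apply, inner_leafSecondFund hg _ _ hz]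
    ring
  smul_left c u v := by
    refine eq_of_inner_eq g (leafSecondFund_mem _ _)
      (Submodule.smul_mem _ _ (leafSecondFund_mem _ _)) fun z hz => ?_
    simp only [map_smul, smul_apply, inner_leafSecondFund hg _ _ hz,
      smul_eq_mul]
    ring
  add_right u v w := by
    refine eq_of_inner_eq g (leafSecondFund_mem _ _)
      (add_mem (leafSecondFund_mem _ _) (leafSecondFund_mem _ _)) fun z hz => ?_
    simp only [map_add, add_apply, inner_leafSecondFund hg _ _ hz]
    ring
  smul_right c u v := by
    refine eq_of_inner_eq g (leafSecondFund_mem _ _)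
      (Submodule.smul_mem _ _ (leafSecondFund_mem _ _)) fun z hz => ?_
    simp only [map_smul, smul_apply, inner_leafSecondFund hg _ _ hz,
      smul_eq_mul]
    ring

/-- By `koszul_self`, `g(∇_E X, E) = ½ (ℒ_X g)(E, E)`. -/
theorem leafDiv_eq_sum_lieMetricForm (hX : DiffField X x) :
    leafDiv g F X x = (1 / 2 : ℝ) * ∑ a, lieMetricForm g X x (orthoBasis g x (F.tangent x) a)
      (orthoBasis g x (F.tangent x) a) := by
  rw [leafDiv, Finset.mul_sum]
  refine Finset.sum_congr rfl fun a _ => ?_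
  have he := mdifferentiableAt_extend (orthoBasis g x (F.tangent x) a)
  have h1 := inner_leviCivita g he hX he
  have h2 := lieMetricForm_apply g X he he
  rw [FiberBundle.extend_apply_self] at h1 h2
  rw [h1, h2, koszul_self]

variable (D) in
-- The term with the derivative of `f` is a multiple of a vector of `𝒟`, which the projection to
-- `𝒟_𝓕` kills.
theorem tensorialAt_integrability_left (Y : (x : M) → TangentSpace (𝓡 (n + p)) x) :
    TensorialAt (𝓡 (n + p)) (Model n p) (fun X => (1 / 2 : ℝ) • D.tang x
      (VectorField.mlieBracket (𝓡 (n + p)) (fun y => D.perp y (X y)) (fun y => D.perp y (Y y)) x))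
      x where
  smul {f X} hf hX := by
    have : (fun y => D.perp y ((f • X) y)) = f • fun y => D.perp y (X y) := by
      ext1 y
      simp
    rw [this, VectorField.mlieBracket_smul_left hf (mdifferentiableAt_perp D hX), map_add, map_smul,
      map_smul, D.tang_of_mem_carrier (D.perp_mem _), smul_zero, zero_add, smul_comm]
  add {X X'} hX hX' := by
    have : (fun y => D.perp y ((X + X') y)) =
        (fun y => D.perp y (X y)) + fun y => D.perp y (X' y) := by
      ext1 y
      simp
    rw [this, VectorField.mlieBracket_add_left (mdifferentiableAt_perp D hX)
      (mdifferentiableAt_perp D hX'), map_add, smul_add]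

variable (D) in
theorem tensorialAt_integrability_right (X : (x : M) → TangentSpace (𝓡 (n + p)) x) :
    TensorialAt (𝓡 (n + p)) (Model n p) (fun Y => (1 / 2 : ℝ) • D.tang x
      (VectorField.mlieBracket (𝓡 (n + p)) (fun y => D.perp y (X y)) (fun y => D.perp y (Y y)) x))
      x where
  smul {f Y} hf hY := by
    have : (fun y => D.perp y ((f • Y) y)) = f • fun y => D.perp y (Y y) := by
      ext1 y
      simp
    rw [this, VectorField.mlieBracket_smul_right hf (mdifferentiableAt_perp D hY), map_add,
      map_smul, map_smul, D.tang_of_mem_carrier (D.perp_mem _), smul_zero, zero_add, smul_comm]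
  add {Y Y'} hY hY' := by
    have : (fun y => D.perp y ((Y + Y') y)) =
        (fun y => D.perp y (Y y)) + fun y => D.perp y (Y' y) := by
      ext1 y
      simp
    rw [this, VectorField.mlieBracket_add_right (mdifferentiableAt_perp D hY)
      (mdifferentiableAt_perp D hY'), map_add, smul_add]

variable (D) in
/-- The integrability tensor as a continuous bilinear map. -/
def integrabilityForm (x : M) : TangentSpace (𝓡 (n + p)) x →L[ℝ] TangentSpace (𝓡 (n + p)) x →L[ℝ]
    TangentSpace (𝓡 (n + p)) x :=
  TensorialAt.mkHom₂ (fun X Y => (1 / 2 : ℝ) • D.tang x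
    (VectorField.mlieBracket (𝓡 (n + p)) (fun y => D.perp y (X y)) (fun y => D.perp y (Y y)) x)) x
    (fun Y _ => tensorialAt_integrability_left D Y)
    (fun X _ => tensorialAt_integrability_right D X)

variable (D) in
theorem integrability_eq_form (v w : TangentSpace (𝓡 (n + p)) x) :
    integrability D x v w = integrabilityForm D x v w :=
  rfl

theorem integrability_eq (hX : DiffField X x) (hY : DiffField Y x) :
    integrability D x (X x) (Y x) = (1 / 2 : ℝ) • D.tang x (VectorField.mlieBracket (𝓡 (n + p))
      (fun y => D.perp y (X y)) (fun y => D.perp y (Y y)) x) := by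
  rw [integrability_eq_form]
  exact TensorialAt.mkHom₂_apply _ _ hX hY

theorem integrability_perp (v w : TangentSpace (𝓡 (n + p)) x) :
    integrability D x (D.perp x v) (D.perp x w) = integrability D x v w := by
  have h := integrability_eq (D := D) (mdifferentiableAt_perpExtend D v)
    (mdifferentiableAt_perpExtend D w)
  rw [D.perpExtend_self, D.perpExtend_self] at h
  rw [h]
  simp only [TransversalDistribution.perpExtend, D.perp_perp]
  rfl

theorem isBilinearMap_integrability : IsBilinearMap ℝ (integrability D x) where
  add_left u v w := by simp [integrability_eq_form]
  smul_left c u v := by simp [integrability_eq_form]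
  add_right u v w := by simp [integrability_eq_form]
  smul_right c u v := by simp [integrability_eq_form]

theorem integrability_mem (v w : TangentSpace (𝓡 (n + p)) x) :
    integrability D x v w ∈ F.tangent x :=
  Submodule.smul_mem _ _ (D.tang_mem _)

end ExtrinsicGeometry

/-! ### Differentiability of the matrix inverse -/

section MatrixInverse

variable {ι : Type*} [Fintype ι] [DecidableEq ι]

theorem differentiable_det_of :
    Differentiable ℝ (fun A : ι → ι → ℝ => (Matrix.of A).det) := by
  simp only [Matrix.det_apply, Matrix.of_apply]
  refine Differentiable.fun_sum fun σ _ => Differentiable.const_smul (fun A => ?_) _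
  exact (HasFDerivAt.finsetProd (u := Finset.univ) (g := fun i (A : ι → ι → ℝ) => A (σ i) i)
    fun i _ => (by fun_prop : Differentiable ℝ (fun A : ι → ι → ℝ => A (σ i) i)).differentiableAt.hasFDerivAt).differentiableAt

theorem differentiableAt_inv_of {A : ι → ι → ℝ} (hA : (Matrix.of A).det ≠ 0) (k l : ι) :
    DifferentiableAt ℝ (fun A : ι → ι → ℝ => (Matrix.of A)⁻¹ k l) A := by
  simp only [Matrix.inv_def, Matrix.smul_apply, Ring.inverse_eq_inv', smul_eq_mul,
    Matrix.adjugate_apply]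
  refine ((differentiable_det_of A).inv hA).mul ?_
  -- Cramer's rule: an adjugate entry is the determinant of the matrix with row `l` replaced by a
  -- constant unit vector.
  have hB : Differentiable ℝ
      (fun (A : ι → ι → ℝ) (i j : ι) => if i = l then (Pi.single k 1 : ι → ℝ) j else A i j) := by
    refine differentiable_pi.2 fun i => differentiable_pi.2 fun j => ?_
    split_ifs <;> fun_prop
  refine (differentiable_det_of.comp hB).differentiableAt.congr_of_eventuallyEq
    (Filter.Eventually.of_forall fun A' => congrArg (Matrix.det : Matrix ι ι ℝ → ℝ) ?_)
  ext i j
  simp [Matrix.updateRow_apply]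

end MatrixInverse

section FiniteSums

variable {n p : ℕ} {M : Type*} [TopologicalSpace M] [ChartedSpace (Model n p) M] {x : M}

theorem mdifferentiableAt_finset_sum {κ : Type*} {t : Finset κ} {f : κ → M → ℝ}
    (hf : ∀ i ∈ t, MDifferentiableAt (𝓡 (n + p)) 𝓘(ℝ, ℝ) (f i) x) :
    MDifferentiableAt (𝓡 (n + p)) 𝓘(ℝ, ℝ) (fun y => ∑ i ∈ t, f i y) x := by
  classical
  induction t using Finset.induction_on with
  | empty => simpa using mdifferentiableAt_const
  | insert a t ha ih =>
    simp only [Finset.sum_insert ha]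
    exact (hf a (Finset.mem_insert_self a t)).add
      (ih fun i hi => hf i (Finset.mem_insert_of_mem hi))

end FiniteSums

/-! ### Traces and norms in an arbitrary basis -/

section Gram

variable {n p : ℕ} {M : Type*} [TopologicalSpace M] [ChartedSpace (Model n p) M]
  [IsManifold (𝓡 (n + p)) ∞ M] (g : Metric n p M) {x : M}
  {ι : Type*} [Fintype ι] [DecidableEq ι]

/-- The inverse of the Gram matrix of a family of tangent vectors. -/
def invGram (s : ι → TangentSpace (𝓡 (n + p)) x) : Matrix ι ι ℝ :=
  (Matrix.of fun k l => g.inner x (s k) (s l))⁻¹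

variable {g} {s : ι → TangentSpace (𝓡 (n + p)) x}

/-- A kernel vector of the Gram matrix gives a combination of the `s k` of length zero. -/
theorem det_gram_ne_zero (hs : LinearIndependent ℝ s) :
    (Matrix.of fun k l => g.inner x (s k) (s l)).det ≠ 0 := by
  intro h
  obtain ⟨c, hc, hc0⟩ := Matrix.exists_mulVec_eq_zero_iff.2 h
  have h1 : g.inner x (∑ l, c l • s l) (∑ l, c l • s l) = 0 := by
    conv_lhs => arg 1; rw [map_sum]
    simp only [sum_apply, map_smul, smul_apply]
    refine Finset.sum_eq_zero fun k _ => ?_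
    have := congrFun hc0 k
    simp only [Matrix.mulVec, dotProduct, Matrix.of_apply, Pi.zero_apply] at this
    simp only [map_sum, map_smul, smul_eq_mul]
    rw [Finset.sum_congr rfl fun i _ => mul_comm (c i) _, this, mul_zero]
  have h2 : ∑ l, c l • s l = 0 := by
    by_contra h2
    exact (g.pos x _ h2).ne' h1
  exact hc (funext (Fintype.linearIndependent_iff.1 hs c h2))

theorem sum_invGram (hs : LinearIndependent ℝ s) (hs' : Submodule.span ℝ (Set.range s) = ⊤)
    (v : TangentSpace (𝓡 (n + p)) x) :
    ∑ k, ∑ l, (invGram g s k l * g.inner x v (s l)) • s k = v := by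
  obtain ⟨c, rfl⟩ := (Submodule.mem_span_range_iff_exists_fun ℝ).1 (hs' ▸ Submodule.mem_top (x := v))
  refine Finset.sum_congr rfl fun k _ => ?_
  rw [← Finset.sum_smul]
  congr 1
  have h1 : invGram g s * (Matrix.of fun k l => g.inner x (s k) (s l)) = 1 :=
    Matrix.nonsing_inv_mul _ (isUnit_iff_ne_zero.2 (det_gram_ne_zero hs))
  have h2 := congrFun (congrArg (fun A => A.mulVec c) h1) k
  rw [← Matrix.mulVec_mulVec, Matrix.one_mulVec] at h2
  rw [← h2]
  simp only [Matrix.mulVec, dotProduct, Matrix.of_apply, map_sum, map_smul, sum_apply, smul_apply,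
    smul_eq_mul]
  refine Finset.sum_congr rfl fun l _ => ?_
  congr 1
  refine Finset.sum_congr rfl fun m _ => ?_
  rw [g.symm, mul_comm]

/-- The trace of a bilinear map over a subspace, in terms of a basis of the tangent space. -/
theorem sum_orthoBasis_eq_sum_invGram (hs : LinearIndependent ℝ s)
    (hs' : Submodule.span ℝ (Set.range s) = ⊤)
    {E : Type*} [AddCommGroup E] [Module ℝ E]
    {V : Submodule ℝ (TangentSpace (𝓡 (n + p)) x)}
    {P : TangentSpace (𝓡 (n + p)) x →ₗ[ℝ] TangentSpace (𝓡 (n + p)) x} (hP : ∀ v, P v ∈ V)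
    (hP' : ∀ w ∈ V, ∀ v, g.inner x (P v) w = g.inner x v w)
    (B : TangentSpace (𝓡 (n + p)) x →ₗ[ℝ] TangentSpace (𝓡 (n + p)) x →ₗ[ℝ] E)
    (hB : ∀ v w, B v (P w) = B v w) :
    ∑ i, B (orthoBasis g x V i) (orthoBasis g x V i) =
      ∑ k, ∑ l, invGram g s k l • B (s k) (s l) := by
  have h1 : ∀ i, B (orthoBasis g x V i) (orthoBasis g x V i) = ∑ k, ∑ l,
      (invGram g s k l * g.inner x (orthoBasis g x V i) (s l)) • B (s k) (orthoBasis g x V i) := by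
    intro i
    conv_lhs =>
      arg 1
      rw [← sum_invGram (g := g) hs hs' (orthoBasis g x V i)]
    simp only [map_sum, map_smul, LinearMap.sum_apply, LinearMap.smul_apply]
  have h2 : ∀ l, P (s l) = ∑ i, g.inner x (orthoBasis g x V i) (s l) • orthoBasis g x V i := by
    intro l
    rw [← sum_inner_smul_orthoBasis g (hP (s l))]
    refine Finset.sum_congr rfl fun i _ => ?_
    rw [hP' _ (orthoBasis_mem g V i), g.symm]
  simp only [h1]
  rw [Finset.sum_comm]
  refine Finset.sum_congr rfl fun k _ => ?_
  rw [Finset.sum_comm]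
  refine Finset.sum_congr rfl fun l _ => ?_
  rw [← hB, h2, map_sum, Finset.smul_sum]
  refine Finset.sum_congr rfl fun i _ => ?_
  rw [map_smul, mul_smul]

/-- `orthoBasis` carries no continuity in the point. This frees the norm from it: in a smooth frame
the right side visibly varies differentiably. `P` is the orthogonal projection to `V`, and `B` must
factor through it since the frame need not lie in `V`. -/
theorem normSq_eq_sum_invGram (hs : LinearIndependent ℝ s)
    (hs' : Submodule.span ℝ (Set.range s) = ⊤)
    {V : Submodule ℝ (TangentSpace (𝓡 (n + p)) x)}
    {P : TangentSpace (𝓡 (n + p)) x →ₗ[ℝ] TangentSpace (𝓡 (n + p)) x} (hP : ∀ v, P v ∈ V)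
    (hP' : ∀ w ∈ V, ∀ v, g.inner x (P v) w = g.inner x v w)
    {B : TangentSpace (𝓡 (n + p)) x → TangentSpace (𝓡 (n + p)) x → TangentSpace (𝓡 (n + p)) x}
    (hB : IsBilinearMap ℝ B) (hBl : ∀ v w, B (P v) w = B v w) (hBr : ∀ v w, B v (P w) = B v w) :
    normSq g x V B = ∑ k, ∑ l, invGram g s k l * ∑ i, ∑ j, invGram g s i j *
      g.inner x (B (s i) (s k)) (B (s j) (s l)) := by
  let L (u w : TangentSpace (𝓡 (n + p)) x) :
      TangentSpace (𝓡 (n + p)) x →ₗ[ℝ] TangentSpace (𝓡 (n + p)) x →ₗ[ℝ] ℝ :=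
    LinearMap.mk₂ ℝ (fun v z => g.inner x (B u v) (B w z))
      (by simp [hB.add_right]) (by simp [hB.smul_right]) (by simp [hB.add_right])
      (by simp [hB.smul_right])
  let R (u w : TangentSpace (𝓡 (n + p)) x) :
      TangentSpace (𝓡 (n + p)) x →ₗ[ℝ] TangentSpace (𝓡 (n + p)) x →ₗ[ℝ] ℝ :=
    LinearMap.mk₂ ℝ (fun v z => g.inner x (B v u) (B z w))
      (by simp [hB.add_left]) (by simp [hB.smul_left]) (by simp [hB.add_left])
      (by simp [hB.smul_left])
  have h1 : ∀ u, ∑ j, g.inner x (B u (orthoBasis g x V j)) (B u (orthoBasis g x V j)) =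
      ∑ k, ∑ l, invGram g s k l * g.inner x (B u (s k)) (B u (s l)) := fun u =>
    sum_orthoBasis_eq_sum_invGram hs hs' hP hP' (L u u) (by simp [L, hBr])
  have h2 : ∀ u w, ∑ j, g.inner x (B (orthoBasis g x V j) u) (B (orthoBasis g x V j) w) =
      ∑ i, ∑ j, invGram g s i j * g.inner x (B (s i) u) (B (s j) w) := fun u w =>
    sum_orthoBasis_eq_sum_invGram hs hs' hP hP' (R u w) (by simp [R, hBl])
  simp only [normSq, h1]
  rw [Finset.sum_comm]
  refine Finset.sum_congr rfl fun k _ => ?_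
  rw [Finset.sum_comm]
  refine Finset.sum_congr rfl fun l _ => ?_
  rw [← h2, Finset.mul_sum]

end Gram

/-! ### Differentiability of norms, connection and leafwise gradient -/

section Smoothness

variable {n p : ℕ} {M : Type*} [TopologicalSpace M] [ChartedSpace (Model n p) M]
  [IsManifold (𝓡 (n + p)) ∞ M] {x : M}
  {X Y Z : (x : M) → TangentSpace (𝓡 (n + p)) x}

/-- A smooth local frame of the tangent bundle near `x`. -/
structure IsFrameNear {ι : Type*} (s : ι → (y : M) → TangentSpace (𝓡 (n + p)) y) (x : M) :
    Prop where
  smooth : ∀ᶠ y in nhds x, ∀ k, SmoothField (s k) y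
  linearIndependent : ∀ᶠ y in nhds x, LinearIndependent ℝ (fun k => s k y)
  span : ∀ᶠ y in nhds x, Submodule.span ℝ (Set.range fun k => s k y) = ⊤

theorem IsFrameNear.diffField {ι : Type*} {s : ι → (y : M) → TangentSpace (𝓡 (n + p)) y}
    (hs : IsFrameNear s x) (k : ι) : DiffField (s k) x :=
  (hs.smooth.self_of_nhds k).mdifferentiableAt (by simp)

theorem exists_isFrameNear (x : M) :
    ∃ s : Fin (Module.finrank ℝ (Model n p)) → (y : M) → TangentSpace (𝓡 (n + p)) y,
      IsFrameNear s x := by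
  let t := trivializationAt (Model n p) (TangentSpace (𝓡 (n + p)) : M → Type _) x
  have x_mem : ∀ᶠ y in nhds x, y ∈ t.baseSet :=
    t.open_baseSet.mem_nhds (FiberBundle.mem_baseSet_trivializationAt _ _ x)
  let b := Module.finBasis ℝ (Model n p)
  refine ⟨t.localFrame b, ?_, ?_, ?_⟩
  · filter_upwards [x_mem] with y hy k
    exact contMDiffAt_localFrame_of_mem ∞ _ b k hy
  · filter_upwards [x_mem] with y hy
    exact (t.isLocalFrameOn_localFrame_baseSet (𝓡 (n + p)) ∞ b).linearIndependent hy
  · filter_upwards [x_mem] with y hy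
    exact top_le_iff.1 ((t.isLocalFrameOn_localFrame_baseSet (𝓡 (n + p)) ∞ b).generating hy)

variable {g : Metric n p M} {ι : Type*} [Fintype ι] [DecidableEq ι]
  {s : ι → (y : M) → TangentSpace (𝓡 (n + p)) y}

theorem IsFrameNear.mdifferentiableAt_invGram (hs : IsFrameNear s x) (k l : ι) :
    MDifferentiableAt (𝓡 (n + p)) 𝓘(ℝ, ℝ) (fun y => invGram g (fun k => s k y) k l) x := by
  have h1 : MDifferentiableAt (𝓡 (n + p)) 𝓘(ℝ, ι → ι → ℝ)
      (fun y => fun k l => g.inner y (s k y) (s l y)) x := by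
    refine ContMDiffAt.mdifferentiableAt (n := ∞) (contMDiffAt_pi_space.2 fun k =>
      contMDiffAt_pi_space.2 fun l => ?_) (by simp)
    exact contMDiffAt_inner g le_rfl (hs.smooth.self_of_nhds k) (hs.smooth.self_of_nhds l)
  exact (differentiableAt_inv_of
    (det_gram_ne_zero hs.linearIndependent.self_of_nhds) k l).comp_mdifferentiableAt h1

theorem IsFrameNear.mdifferentiableAt_normSq (hs : IsFrameNear s x)
    {V : (y : M) → Submodule ℝ (TangentSpace (𝓡 (n + p)) y)}
    {P : (y : M) → TangentSpace (𝓡 (n + p)) y →ₗ[ℝ] TangentSpace (𝓡 (n + p)) y}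
    (hP : ∀ y v, P y v ∈ V y) (hP' : ∀ y, ∀ w ∈ V y, ∀ v, g.inner y (P y v) w = g.inner y v w)
    {B : (y : M) → TangentSpace (𝓡 (n + p)) y → TangentSpace (𝓡 (n + p)) y →
      TangentSpace (𝓡 (n + p)) y}
    (hB : ∀ y, IsBilinearMap ℝ (B y)) (hBl : ∀ y v w, B y (P y v) w = B y v w)
    (hBr : ∀ y v w, B y v (P y w) = B y v w)
    (hd : ∀ k l, DiffField (fun y => B y (s k y) (s l y)) x) :
    MDifferentiableAt (𝓡 (n + p)) 𝓘(ℝ, ℝ) (fun y => normSq g y (V y) (B y)) x := by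
  have h : MDifferentiableAt (𝓡 (n + p)) 𝓘(ℝ, ℝ) (fun y => ∑ k, ∑ l,
      invGram g (fun k => s k y) k l * ∑ i, ∑ j, invGram g (fun k => s k y) i j *
      g.inner y (B y (s i y) (s k y)) (B y (s j y) (s l y))) x := by
    refine mdifferentiableAt_finset_sum fun k _ => mdifferentiableAt_finset_sum fun l _ =>
      (hs.mdifferentiableAt_invGram k l).mul (mdifferentiableAt_finset_sum fun i _ =>
        mdifferentiableAt_finset_sum fun j _ => (hs.mdifferentiableAt_invGram i j).mul ?_)
    exact mdifferentiableAt_inner g (hd i k) (hd j l)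
  refine h.congr_of_eventuallyEq ?_
  filter_upwards [hs.linearIndependent, hs.span] with y h1 h2
  exact normSq_eq_sum_invGram h1 h2 (hP y) (hP' y) (hB y) (hBl y) (hBr y)

theorem mdifferentiableAt_mvfderiv_apply {f : M → ℝ}
    (hf : ContMDiffAt (𝓡 (n + p)) 𝓘(ℝ, ℝ) 2 f x) (hX : DiffField X x) :
    MDifferentiableAt (𝓡 (n + p)) 𝓘(ℝ, ℝ) (fun y => mvfderiv (𝓡 (n + p)) f y (X y)) x := by
  have h1 := (hf.mfderiv_const (m := 1) (by norm_num)).mdifferentiableAt (by simp)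
  have h2 := MDifferentiableAt.clm_apply_of_inCoordinates
    (E₁ := (TangentSpace (𝓡 (n + p)) : M → Type _)) (E₂ := (TangentSpace 𝓘(ℝ, ℝ) : ℝ → Type _))
    (b₁ := id) (b₂ := f) (ϕ := fun y => mfderiv (𝓡 (n + p)) 𝓘(ℝ, ℝ) f y) (v := X)
    h1 hX (hf.mdifferentiableAt (by simp))
  have h3 := ((mdifferentiableAt_totalSpace _ _).1 h2).2
  simp at h3
  exact h3

theorem diffField_mlieBracket (hX : SmoothField X x) (hY : SmoothField Y x) :
    DiffField (VectorField.mlieBracket (𝓡 (n + p)) X Y) x := by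
  have : IsManifold (𝓡 (n + p)) (((2 : ℕ∞) : WithTop ℕ∞) + 1) M :=
    IsManifold.of_le (n := ∞) (by exact_mod_cast le_top)
  have : IsManifold (𝓡 (n + p)) (minSmoothness ℝ 2) M := by
    rw [minSmoothness_of_isRCLikeNormedField]
    exact IsManifold.of_le (n := ∞) ENat.LEInfty.out
  have h := ContMDiffAt.mlieBracket_vectorField (m := 1) (n := 2) (hX.of_le ENat.LEInfty.out)
    (hY.of_le ENat.LEInfty.out)
    (by rw [minSmoothness_of_isRCLikeNormedField]; exact_mod_cast le_rfl)
  exact h.mdifferentiableAt (by simp)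

theorem mdifferentiableAt_koszul (hX : SmoothField X x) (hY : SmoothField Y x)
    (hZ : SmoothField Z x) :
    MDifferentiableAt (𝓡 (n + p)) 𝓘(ℝ, ℝ) (koszul g X Y Z) x := by
  have hd : ∀ {V : (x : M) → TangentSpace (𝓡 (n + p)) x}, SmoothField V x → DiffField V x := fun h => h.mdifferentiableAt (by simp)
  have hf : ∀ {U V W : (x : M) → TangentSpace (𝓡 (n + p)) x}, SmoothField U x → SmoothField V x → SmoothField W x →
      MDifferentiableAt (𝓡 (n + p)) 𝓘(ℝ, ℝ)
        (fun y => mvfderiv (𝓡 (n + p)) (fun y => g.inner y (U y) (V y)) y (W y)) x :=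
    fun hU hV hW => mdifferentiableAt_mvfderiv_apply
      ((contMDiffAt_inner g le_rfl hU hV).of_le ENat.LEInfty.out) (hd hW)
  exact (((((hf hY hZ hX).add (hf hX hZ hY)).sub (hf hX hY hZ)).add
    (mdifferentiableAt_inner g (diffField_mlieBracket hX hY) (hd hZ))).sub
    (mdifferentiableAt_inner g (diffField_mlieBracket hX hZ) (hd hY))).sub
    (mdifferentiableAt_inner g (diffField_mlieBracket hY hZ) (hd hX))

/-- Pairings of `∇_X Y` with a frame are Koszul expressions; the inverse Gram matrix recovers the
field from them. -/
theorem diffField_leviCivita (hX : ∀ᶠ y in nhds x, SmoothField X y)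
    (hY : ∀ᶠ y in nhds x, SmoothField Y y) :
    DiffField (leviCivita g X Y) x := by
  obtain ⟨s, hs⟩ := exists_isFrameNear (n := n) (p := p) x
  have h : DiffField (fun y => ∑ k, ∑ l,
      (invGram g (fun k => s k y) k l * ((1 / 2 : ℝ) * koszul g X Y (s l) y)) • s k y) x := by
    refine MDifferentiableAt.sum_section fun k _ => MDifferentiableAt.sum_section fun l _ =>
      MDifferentiableAt.smul_section (MDifferentiableAt.mul (hs.mdifferentiableAt_invGram k l)
        (MDifferentiableAt.mul mdifferentiableAt_const (mdifferentiableAt_koszul hX.self_of_nhds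
          hY.self_of_nhds (hs.smooth.self_of_nhds l)))) (hs.diffField k)
  refine h.congr_of_eventuallyEq ?_
  filter_upwards [hs.linearIndependent, hs.span, hs.smooth, hX, hY] with y h1 h2 h3 h4 h5
  congr 1
  conv_lhs => rw [← sum_invGram (g := g) h1 h2 (leviCivita g X Y y)]
  refine Finset.sum_congr rfl fun k _ => Finset.sum_congr rfl fun l _ => ?_
  rw [inner_leviCivita g (h4.mdifferentiableAt (by simp)) (h5.mdifferentiableAt (by simp))
    ((h3 l).mdifferentiableAt (by simp))]

variable {F : Foliation n p M} {D : TransversalDistribution F}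

theorem mdifferentiableAt_normSq_integrability (hg : IsAdapted g D) :
    MDifferentiableAt (𝓡 (n + p)) 𝓘(ℝ, ℝ)
      (fun y => normSq g y (D.carrier y) (integrability D y)) x := by
  obtain ⟨s, hs⟩ := exists_isFrameNear (n := n) (p := p) x
  refine hs.mdifferentiableAt_normSq (P := D.perp) (fun y => D.perp_mem)
    (fun y w hw => hg.inner_perp hw) (fun y => isBilinearMap_integrability)
    (fun y v w => ?_) (fun y v w => ?_) fun k l => ?_
  · rw [← integrability_perp, D.perp_perp, integrability_perp]
  · rw [← integrability_perp, D.perp_perp, integrability_perp]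
  · have h : DiffField (fun y => (1 / 2 : ℝ) • D.tang y (VectorField.mlieBracket (𝓡 (n + p))
        (fun y => D.perp y (s k y)) (fun y => D.perp y (s l y)) y)) x :=
      MDifferentiableAt.smul_section mdifferentiableAt_const
        (mdifferentiableAt_tang D (diffField_mlieBracket
          (contMDiffAt_perp D (hs.smooth.self_of_nhds k))
          (contMDiffAt_perp D (hs.smooth.self_of_nhds l))))
    refine h.congr_of_eventuallyEq ?_
    filter_upwards [hs.smooth] with y h3
    rw [integrability_eq ((h3 k).mdifferentiableAt (by simp)) ((h3 l).mdifferentiableAt (by simp))]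

theorem mdifferentiableAt_normSq_leafSecondFund (hg : IsAdapted g D) :
    MDifferentiableAt (𝓡 (n + p)) 𝓘(ℝ, ℝ)
      (fun y => normSq g y (F.tangent y) (leafSecondFund g D y)) x := by
  obtain ⟨s, hs⟩ := exists_isFrameNear (n := n) (p := p) x
  refine hs.mdifferentiableAt_normSq (P := D.tang) (fun y => D.tang_mem)
    (fun y w hw => hg.inner_tang hw) (fun y => isBilinearMap_leafSecondFund hg)
    (fun y v w => ?_) (fun y v w => ?_) fun k l => ?_
  · rw [← leafSecondFund_tang hg, D.tang_tang, leafSecondFund_tang hg]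
  · rw [← leafSecondFund_tang hg, D.tang_tang, leafSecondFund_tang hg]
  · have h : DiffField (fun y => D.perp y (leviCivita g
        (fun y => D.tang y (s k y)) (fun y => D.tang y (s l y)) y)) x := by
      refine mdifferentiableAt_perp D (diffField_leviCivita ?_ ?_)
      · filter_upwards [hs.smooth] with y h3 using contMDiffAt_tang D (h3 k)
      · filter_upwards [hs.smooth] with y h3 using contMDiffAt_tang D (h3 l)
    refine h.congr_of_eventuallyEq ?_
    filter_upwards [hs.smooth] with y h3
    rw [leafSecondFund_eq hg ((h3 k).mdifferentiableAt (by simp))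
      ((h3 l).mdifferentiableAt (by simp))]

theorem inner_gradient (f : M → ℝ) (v : TangentSpace (𝓡 (n + p)) x) :
    g.inner x (gradient g f x) v = mvfderiv (𝓡 (n + p)) f x v := by
  conv_rhs => rw [← sum_inner_smul_orthoBasis g (Submodule.mem_top (x := v))]
  simp only [gradient, map_sum, map_smul, sum_apply, smul_apply, smul_eq_mul]
  refine Finset.sum_congr rfl fun i _ => ?_
  rw [g.symm, mul_comm]

theorem inner_leafGradient (hg : IsAdapted g D) (f : M → ℝ) {v : TangentSpace (𝓡 (n + p)) x}
    (hv : v ∈ F.tangent x) :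
    g.inner x (leafGradient g D f x) v = mvfderiv (𝓡 (n + p)) f x v := by
  rw [leafGradient, hg.inner_tang hv, inner_gradient]

theorem leafGradient_mem (f : M → ℝ) : leafGradient g D f x ∈ F.tangent x :=
  D.tang_mem _

/-- Needed to take the leafwise divergence of the gradient; this is where class `C²` enters. -/
theorem diffField_leafGradient (hg : IsAdapted g D) {f : M → ℝ}
    (hf : ContMDiffAt (𝓡 (n + p)) 𝓘(ℝ, ℝ) 2 f x) : DiffField (leafGradient g D f) x := by
  obtain ⟨s, hs⟩ := exists_isFrameNear (n := n) (p := p) x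
  have h : DiffField (fun y => ∑ k, ∑ l, (invGram g (fun k => s k y) k l *
      mvfderiv (𝓡 (n + p)) f y (D.tang y (s l y))) • s k y) x := by
    refine MDifferentiableAt.sum_section fun k _ => MDifferentiableAt.sum_section fun l _ =>
      MDifferentiableAt.smul_section (MDifferentiableAt.mul (hs.mdifferentiableAt_invGram k l)
        (mdifferentiableAt_mvfderiv_apply hf (mdifferentiableAt_tang D (hs.diffField l))))
        (hs.diffField k)
  refine h.congr_of_eventuallyEq ?_
  filter_upwards [hs.linearIndependent, hs.span] with y h1 h2
  congr 1
  conv_lhs => rw [← sum_invGram (g := g) h1 h2 (leafGradient g D f y)]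
  refine Finset.sum_congr rfl fun k _ => Finset.sum_congr rfl fun l _ => ?_
  rw [← inner_leafGradient hg f (D.tang_mem _), g.symm y _ (D.tang y _),
    hg.inner_tang (leafGradient_mem f), g.symm]

end Smoothness

/-! ### Transformation formulas for two metrics proportional along `𝒟` -/

section ConformalChange

variable {n p : ℕ} {M : Type*} [TopologicalSpace M] [ChartedSpace (Model n p) M]
  [IsManifold (𝓡 (n + p)) ∞ M] {x : M}

/-- The adapted metrics `g` and `g'` coincide along the leaves, and `g' = ρ g` along `𝒟`. -/
structure IsConformalChange {F : Foliation n p M} (D : TransversalDistribution F)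
    (g g' : Metric n p M) (ρ : M → ℝ) : Prop where
  adapted : IsAdapted g D
  adapted' : IsAdapted g' D
  pos : ∀ x, 0 < ρ x
  mdifferentiable : ∀ x, MDifferentiableAt (𝓡 (n + p)) 𝓘(ℝ, ℝ) ρ x
  inner_tangent : ∀ x, ∀ v ∈ F.tangent x, ∀ w ∈ F.tangent x, g'.inner x v w = g.inner x v w
  inner_carrier : ∀ x, ∀ v ∈ D.carrier x, ∀ w ∈ D.carrier x,
    g'.inner x v w = ρ x * g.inner x v w

namespace IsConformalChange

variable {F : Foliation n p M} {D : TransversalDistribution F} {g g' : Metric n p M} {ρ : M → ℝ}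
  {X Y Z : (x : M) → TangentSpace (𝓡 (n + p)) x}

theorem inner_of_mem_tangent (h : IsConformalChange D g g' ρ) {w : TangentSpace (𝓡 (n + p)) x}
    (hw : w ∈ F.tangent x) (v : TangentSpace (𝓡 (n + p)) x) :
    g'.inner x v w = g.inner x v w := by
  rw [← h.adapted'.inner_tang hw, ← h.adapted.inner_tang hw,
    h.inner_tangent x _ (D.tang_mem v) w hw]

theorem inner_of_mem_carrier (h : IsConformalChange D g g' ρ) {w : TangentSpace (𝓡 (n + p)) x}
    (hw : w ∈ D.carrier x) (v : TangentSpace (𝓡 (n + p)) x) :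
    g'.inner x v w = ρ x * g.inner x v w := by
  rw [← h.adapted'.inner_perp hw, ← h.adapted.inner_perp hw,
    h.inner_carrier x _ (D.perp_mem v) w hw]

theorem lieMetric_of_tangent (h : IsConformalChange D g g' ρ) (hX : ∀ y, X y ∈ F.tangent y)
    (hY : ∀ y, Y y ∈ F.tangent y) : lieMetric g' Z X Y x = lieMetric g Z X Y x := by
  have : (fun y => g'.inner y (X y) (Y y)) = fun y => g.inner y (X y) (Y y) :=
    funext fun y => h.inner_of_mem_tangent (hY y) _
  rw [lieMetric, lieMetric, this, h.inner_of_mem_tangent (hY x), h.inner_of_mem_tangent (hX x)]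

/-- Only the derivative term sees `ρ` as a function, and the product rule there yields `dρ(Z)`, the
source of every `∇^𝓕 ρ` below. -/
theorem lieMetric_of_carrier (h : IsConformalChange D g g' ρ) (hX : ∀ y, X y ∈ D.carrier y)
    (hY : ∀ y, Y y ∈ D.carrier y) (hdX : DiffField X x) (hdY : DiffField Y x) :
    lieMetric g' Z X Y x = ρ x * lieMetric g Z X Y x +
      mvfderiv (𝓡 (n + p)) ρ x (Z x) * g.inner x (X x) (Y x) := by
  have h1 : (fun y => g'.inner y (X y) (Y y)) = fun y => ρ y * g.inner y (X y) (Y y) :=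
    funext fun y => h.inner_of_mem_carrier (hY y) _
  have h2 : mvfderiv (𝓡 (n + p)) (fun y => ρ y * g.inner y (X y) (Y y)) x (Z x) =
        ρ x * mvfderiv (𝓡 (n + p)) (fun y => g.inner y (X y) (Y y)) x (Z x) +
        g.inner x (X x) (Y x) * mvfderiv (𝓡 (n + p)) ρ x (Z x) := by
    simp [mvfderiv_fun_mul (h.mdifferentiable x) (mdifferentiableAt_inner g hdX hdY)]
  rw [lieMetric, lieMetric, h1, h2, h.inner_of_mem_carrier (hY x), h.inner_of_mem_carrier (hX x)]
  ring

theorem lieMetricForm_tangent (h : IsConformalChange D g g' ρ) (Z)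
    {v w : TangentSpace (𝓡 (n + p)) x} (hv : v ∈ F.tangent x) (hw : w ∈ F.tangent x) :
    lieMetricForm g' Z x v w = lieMetricForm g Z x v w := by
  have hdv := mdifferentiableAt_tangExtend D v
  have hdw := mdifferentiableAt_tangExtend D w
  have h1 := lieMetricForm_apply g Z hdv hdw
  have h2 := lieMetricForm_apply g' Z hdv hdw
  rw [D.tangExtend_self, D.tangExtend_self, D.tang_of_mem hv, D.tang_of_mem hw] at h1 h2
  rw [h1, h2]
  exact h.lieMetric_of_tangent (fun y => D.tang_mem _) (fun y => D.tang_mem _)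

theorem lieMetricForm_perp (h : IsConformalChange D g g' ρ) (Z)
    (v w : TangentSpace (𝓡 (n + p)) x) :
    lieMetricForm g' Z x (D.perp x v) (D.perp x w) =
      ρ x * lieMetricForm g Z x (D.perp x v) (D.perp x w) +
      mvfderiv (𝓡 (n + p)) ρ x (Z x) * g.inner x (D.perp x v) (D.perp x w) := by
  have hdv := mdifferentiableAt_perpExtend D v
  have hdw := mdifferentiableAt_perpExtend D w
  have h1 := lieMetricForm_apply g Z hdv hdw
  have h2 := lieMetricForm_apply g' Z hdv hdw
  have h3 := h.lieMetric_of_carrier (Z := Z) (X := D.perpExtend v) (Y := D.perpExtend w)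
    (fun y => D.perp_mem _) (fun y => D.perp_mem _) hdv hdw
  rw [D.perpExtend_self, D.perpExtend_self] at h1 h2 h3
  rw [h1, h2, h3]

theorem leafGradient_eq (h : IsConformalChange D g g' ρ) (f : M → ℝ) :
    leafGradient g' D f = leafGradient g D f :=
  funext fun x => eq_of_inner_eq g (leafGradient_mem f) (leafGradient_mem f) fun z hz => by
    rw [← h.inner_of_mem_tangent hz, inner_leafGradient h.adapted' f hz,
      inner_leafGradient h.adapted f hz]

theorem secondFund_eq (h : IsConformalChange D g g' ρ) (v w : TangentSpace (𝓡 (n + p)) x) :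
    secondFund g' D x v w = ρ x • secondFund g D x v w -
      ((1 / 2 : ℝ) * g.inner x (D.perp x v) (D.perp x w)) • leafGradient g D ρ x := by
  refine eq_of_inner_eq g (secondFund_mem _ _) (sub_mem (Submodule.smul_mem _ _ (secondFund_mem _ _))
    (Submodule.smul_mem _ _ (leafGradient_mem ρ))) fun z hz => ?_
  rw [← h.inner_of_mem_tangent hz, inner_secondFund h.adapted' _ _ hz, h.lieMetricForm_perp,
    D.tangExtend_self, D.tang_of_mem hz]
  simp only [map_sub, sub_apply, map_smul, smul_apply, smul_eq_mul, inner_leafGradient h.adapted ρ hz,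
    inner_secondFund h.adapted _ _ hz]
  ring

/-- The Lie derivative on leaf vectors is unchanged, so `ρ⁻¹` comes only from pairing values in `𝒟`
with `g' = ρ g`. -/
theorem leafSecondFund_eq (h : IsConformalChange D g g' ρ) (v w : TangentSpace (𝓡 (n + p)) x) :
    leafSecondFund g' D x v w = (ρ x)⁻¹ • leafSecondFund g D x v w := by
  refine eq_of_inner_eq g (leafSecondFund_mem _ _)
    (Submodule.smul_mem _ _ (leafSecondFund_mem _ _)) fun z hz => ?_
  have h1 := h.inner_of_mem_carrier hz (leafSecondFund g' D x v w)
  rw [inner_leafSecondFund h.adapted' _ _ hz, h.lieMetricForm_tangent _ (D.tang_mem _)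
    (D.tang_mem _), ← inner_leafSecondFund h.adapted _ _ hz] at h1
  rw [map_smul, smul_apply, smul_eq_mul, h1, inv_mul_cancel_left₀ (h.pos x).ne']

theorem inner_perp_orthoBasis {g : Metric n p M} (x : M)
    (i j : Fin (Module.finrank ℝ (D.carrier x))) :
    g.inner x (D.perp x (orthoBasis g x (D.carrier x) i))
      (D.perp x (orthoBasis g x (D.carrier x) j)) = if i = j then 1 else 0 := by
  rw [D.perp_of_mem (orthoBasis_mem g _ i), D.perp_of_mem (orthoBasis_mem g _ j),
    inner_orthoBasis]

/-- Taking the trace in `g'` instead of `g` divides by `ρ`, and the trace of `g^⊥` over `𝒟` is `n`.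
-/
theorem meanCurvature_eq (h : IsConformalChange D g g' ρ) (x : M) :
    meanCurvature g' D x =
      meanCurvature g D x - ((n : ℝ) / 2 * (ρ x)⁻¹) • leafGradient g D ρ x := by
  have h1 := sum_orthoBasis_of_conformal g g' (h.pos x).ne' (h.inner_carrier x)
    (isBilinearMap_secondFund h.adapted').toLinearMap
  have h2 : meanCurvature g' D x = (ρ x)⁻¹ • ∑ i, secondFund g' D x
      (orthoBasis g x (D.carrier x) i) (orthoBasis g x (D.carrier x) i) := h1
  rw [h2]
  simp only [h.secondFund_eq, inner_perp_orthoBasis, Finset.sum_sub_distrib, ← Finset.smul_sum]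
  simp only [if_true, Finset.sum_const, Finset.card_univ, Fintype.card_fin, D.finrank_carrier]
  rw [smul_sub, inv_smul_smul₀ (h.pos x).ne', meanCurvature, ← Nat.cast_smul_eq_nsmul ℝ, smul_smul,
    smul_smul]
  congr 2
  ring

/-- The change of `h` beyond scaling is a multiple of `g^⊥`, invisible to the trace-free part; the
factor `ρ²` of the squared values meets `ρ⁻²` from the two slots. In coordinates, the cross and
gradient terms of `n‖h'‖²` and `‖H'‖²` coincide. -/
theorem beta_eq (h : IsConformalChange D g g' ρ) (x : M) : beta g' D x = beta g D x := by
  have hρ := (h.pos x).ne'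
  have h1 := sum_sum_orthoBasis_of_conformal g g' hρ (h.inner_carrier x)
    (isBilinearMap_secondFund h.adapted') g'
  have h2 : normSq g' x (D.carrier x) (secondFund g' D x) = (ρ x ^ 2)⁻¹ * ∑ i, ∑ j, g.inner x
      (secondFund g' D x (orthoBasis g x (D.carrier x) i) (orthoBasis g x (D.carrier x) j))
      (secondFund g' D x (orthoBasis g x (D.carrier x) i) (orthoBasis g x (D.carrier x) j)) := by
    rw [normSq, h1]
    simp only [h.inner_of_mem_tangent (secondFund_mem _ _)]
  have h3 : ∑ i, ∑ j, g.inner x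
      (secondFund g' D x (orthoBasis g x (D.carrier x) i) (orthoBasis g x (D.carrier x) j))
      (secondFund g' D x (orthoBasis g x (D.carrier x) i) (orthoBasis g x (D.carrier x) j)) =
      ρ x ^ 2 * normSq g x (D.carrier x) (secondFund g D x)
      - ρ x * g.inner x (meanCurvature g D x) (leafGradient g D ρ x)
      + (n : ℝ) / 4 * g.inner x (leafGradient g D ρ x) (leafGradient g D ρ x) := by
    have h4 : ∀ i j, g.inner x
        (secondFund g' D x (orthoBasis g x (D.carrier x) i) (orthoBasis g x (D.carrier x) j))
        (secondFund g' D x (orthoBasis g x (D.carrier x) i) (orthoBasis g x (D.carrier x) j)) =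
        ρ x ^ 2 * g.inner x
          (secondFund g D x (orthoBasis g x (D.carrier x) i) (orthoBasis g x (D.carrier x) j))
          (secondFund g D x (orthoBasis g x (D.carrier x) i) (orthoBasis g x (D.carrier x) j))
        + if i = j then
          (- ρ x * g.inner x
          (secondFund g D x (orthoBasis g x (D.carrier x) i) (orthoBasis g x (D.carrier x) j))
            (leafGradient g D ρ x)
          + 1 / 4 * g.inner x (leafGradient g D ρ x) (leafGradient g D ρ x)) else 0 := by
      intro i j
      rw [h.secondFund_eq, inner_perp_orthoBasis]
      split_ifs with hij
      · simp only [map_sub, sub_apply, map_smul, smul_apply, smul_eq_mul,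
          g.symm x (leafGradient g D ρ x) (secondFund g D x _ _)]
        ring
      · simp only [map_sub, sub_apply, map_smul, smul_apply, smul_eq_mul]
        ring
    simp only [h4, Finset.sum_add_distrib, Finset.sum_ite_eq, Finset.mem_univ, if_true, normSq,
      meanCurvature, Finset.mul_sum, map_sum, sum_apply, Finset.sum_const, Finset.card_univ,
      Fintype.card_fin, D.finrank_carrier, nsmul_eq_mul, neg_mul, Finset.sum_neg_distrib]
    ring
  have h5 : meanCurvature g' D x ∈ F.tangent x := Submodule.sum_mem _ fun i _ => secondFund_mem _ _
  rw [beta, beta, h2, h3, h.inner_of_mem_tangent h5, h.meanCurvature_eq]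
  congr 1
  simp only [map_sub, sub_apply, map_smul, smul_apply, smul_eq_mul,
    g.symm x (leafGradient g D ρ x) (meanCurvature g D x)]
  field_simp
  ring

/-- `T` does not involve the metric and has values along the leaves, so only its two `𝒟`-slots
scale. -/
theorem normT_eq (h : IsConformalChange D g g' ρ) (x : M) :
    normT g' D x = (ρ x)⁻¹ * normT g D x := by
  have h1 := sum_sum_orthoBasis_of_conformal g g' (h.pos x).ne' (h.inner_carrier x)
    (isBilinearMap_integrability (D := D)) g'
  simp only [h.inner_of_mem_tangent (integrability_mem _ _)] at h1
  simp only [normT, normSq, h.inner_of_mem_tangent (integrability_mem _ _)]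
  rw [h1, Real.sqrt_mul (by positivity), Real.sqrt_inv, Real.sqrt_sq (h.pos x).le]

/-- The leaf slots do not scale. The squared length of the value changes by `ρ * ρ⁻² = ρ⁻¹`. -/
theorem normLeafSecondFund_eq (h : IsConformalChange D g g' ρ) (x : M) :
    normLeafSecondFund g' D x = (√(ρ x))⁻¹ * normLeafSecondFund g D x := by
  have h1 := sum_sum_orthoBasis_of_conformal g g' one_ne_zero
    (fun v hv w hw => by rw [h.inner_tangent x v hv w hw, one_mul])
    (isBilinearMap_leafSecondFund h.adapted') g'
  have h2 : normSq g' x (F.tangent x) (leafSecondFund g' D x) =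
      (ρ x)⁻¹ * normSq g x (F.tangent x) (leafSecondFund g D x) := by
    rw [normSq, h1, one_pow, inv_one, one_mul, normSq, Finset.mul_sum]
    refine Finset.sum_congr rfl fun i _ => ?_
    rw [Finset.mul_sum]
    refine Finset.sum_congr rfl fun j _ => ?_
    rw [h.inner_of_mem_carrier (leafSecondFund_mem _ _), h.leafSecondFund_eq]
    simp only [map_smul, smul_apply, smul_eq_mul]
    rw [mul_inv_cancel_left₀ (h.pos x).ne']
  rw [normLeafSecondFund, h2, Real.sqrt_mul (inv_nonneg.2 (h.pos x).le), Real.sqrt_inv,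
    normLeafSecondFund]

theorem leafDiv_eq (h : IsConformalChange D g g' ρ) (hX : DiffField X x) :
    leafDiv g' F X x = leafDiv g F X x := by
  have h1 := sum_orthoBasis_of_conformal g g' one_ne_zero
    (fun v hv w hw => by rw [h.inner_tangent x v hv w hw, one_mul])
    (E := ℝ) (LinearMap.mk₂ ℝ (fun v w => lieMetricForm g' X x v w) (by simp) (by simp) (by simp)
      (by simp))
  simp only [LinearMap.mk₂_apply, inv_one, one_smul] at h1
  rw [leafDiv_eq_sum_lieMetricForm hX, leafDiv_eq_sum_lieMetricForm hX, h1]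
  congr 1
  exact Finset.sum_congr rfl fun i _ =>
    h.lieMetricForm_tangent X (orthoBasis_mem g _ i) (orthoBasis_mem g _ i)

theorem schrodinger_eq (h : IsConformalChange D g g' ρ) {u : M → ℝ}
    (hu : ContMDiffAt (𝓡 (n + p)) 𝓘(ℝ, ℝ) 2 u x) :
    schrodinger g' D u x = schrodinger g D u x := by
  rw [schrodinger, schrodinger, h.beta_eq, leafLaplacian, leafLaplacian, h.leafGradient_eq,
    h.leafDiv_eq (diffField_leafGradient h.adapted hu)]

end IsConformalChange

end ConformalChange

/-! ### Derivatives of square roots and logarithms -/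

section Logarithm

variable {n p : ℕ} {M : Type*} [TopologicalSpace M] [ChartedSpace (Model n p) M] {x : M}

theorem mdifferentiableAt_sqrt {f : M → ℝ}
    (hf : MDifferentiableAt (𝓡 (n + p)) 𝓘(ℝ, ℝ) f x) (hx : 0 < √(f x)) :
    MDifferentiableAt (𝓡 (n + p)) 𝓘(ℝ, ℝ) (fun y => √(f y)) x :=
  (Real.hasDerivAt_sqrt (Real.sqrt_pos.1 hx).ne').differentiableAt.comp_mdifferentiableAt hf

theorem mdifferentiableAt_log {f : M → ℝ}
    (hf : MDifferentiableAt (𝓡 (n + p)) 𝓘(ℝ, ℝ) f x) (hx : f x ≠ 0) :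
    MDifferentiableAt (𝓡 (n + p)) 𝓘(ℝ, ℝ) (fun y => Real.log (f y)) x :=
  (Real.differentiableAt_log hx).comp_mdifferentiableAt hf

theorem mvfderiv_log_apply {f : M → ℝ}
    (hf : MDifferentiableAt (𝓡 (n + p)) 𝓘(ℝ, ℝ) f x) (hx : f x ≠ 0)
    (v : TangentSpace (𝓡 (n + p)) x) :
    mvfderiv (𝓡 (n + p)) (fun y => Real.log (f y)) x v =
      (f x)⁻¹ * mvfderiv (𝓡 (n + p)) f x v := by
  have h1 : ∀ w : ℝ, fderiv ℝ Real.log (f x) w = (f x)⁻¹ * w := fun w => by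
    rw [(Real.hasDerivAt_log hx).hasFDerivAt.fderiv]
    simp [mul_comm]
  have h2 := mvfderiv_comp x (Real.differentiableAt_log hx).mdifferentiableAt hf
  refine (congrArg (fun A => A v) h2).trans ?_
  simp only [mvfderiv, mfderiv_eq_fderiv]
  exact h1 _

theorem mvfderiv_congr {f f' : M → ℝ} (h : f =ᶠ[nhds x] f') :
    mvfderiv (𝓡 (n + p)) f x = mvfderiv (𝓡 (n + p)) f' x := by
  unfold mvfderiv
  rw [h.mfderiv_eq, h.eq_of_nhds]

end Logarithm

/-! ### Invariants of a conformal change and integration of the flow -/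

section Variation

variable {n p : ℕ} {M : Type*} [TopologicalSpace M] [ChartedSpace (Model n p) M]
  [IsManifold (𝓡 (n + p)) ∞ M] {F : Foliation n p M} {D : TransversalDistribution F} {x : M}

theorem mdifferentiableAt_normT {g : Metric n p M} (hg : IsAdapted g D) (hx : 0 < normT g D x) :
    MDifferentiableAt (𝓡 (n + p)) 𝓘(ℝ, ℝ) (normT g D) x :=
  mdifferentiableAt_sqrt (f := fun y => normSq g y (D.carrier y) (integrability D y))
    (mdifferentiableAt_normSq_integrability hg) hx

theorem mdifferentiableAt_normLeafSecondFund {g : Metric n p M} (hg : IsAdapted g D)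
    (hx : 0 < normLeafSecondFund g D x) :
    MDifferentiableAt (𝓡 (n + p)) 𝓘(ℝ, ℝ) (normLeafSecondFund g D) x :=
  mdifferentiableAt_sqrt (f := fun y => normSq g y (F.tangent y) (leafSecondFund g D y))
    (mdifferentiableAt_normSq_leafSecondFund hg) hx

/-- Applied with `c = 1` for `‖T‖` and `c = 1/2` for `‖h_𝓕‖`; the prefactors `n/2` and `n` then both
produce the `(n/2) ∇^𝓕 log ρ` in the change of `H`. -/
theorem leafGradient_log_eq {g : Metric n p M} (hg : IsAdapted g D) {a b ρ : M → ℝ} {c : ℝ}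
    (ha : MDifferentiableAt (𝓡 (n + p)) 𝓘(ℝ, ℝ) a x) (hax : 0 < a x)
    (hρ : MDifferentiableAt (𝓡 (n + p)) 𝓘(ℝ, ℝ) ρ x) (hρx : 0 < ρ x)
    (hb : ∀ᶠ y in nhds x, Real.log (b y) = Real.log (a y) - c * Real.log (ρ y)) :
    leafGradient g D (fun y => Real.log (b y)) x = leafGradient g D (fun y => Real.log (a y)) x -
      (c * (ρ x)⁻¹) • leafGradient g D ρ x := by
  refine eq_of_inner_eq g (leafGradient_mem _)
    (sub_mem (leafGradient_mem _) (Submodule.smul_mem _ _ (leafGradient_mem _))) fun z hz => ?_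
  simp only [map_sub, sub_apply, map_smul, smul_apply, smul_eq_mul, inner_leafGradient hg _ hz]
  have h1 : MDifferentiableAt (𝓡 (n + p)) 𝓘(ℝ, ℝ) (fun y => c * Real.log (ρ y)) x :=
    mdifferentiableAt_const.mul (mdifferentiableAt_log hρ hρx.ne')
  rw [mvfderiv_congr hb, mvfderiv_fun_sub (mdifferentiableAt_log ha hax.ne') h1,
    mvfderiv_fun_mul mdifferentiableAt_const (mdifferentiableAt_log hρ hρx.ne')]
  simp only [mvfderiv_const, smul_zero, add_zero, sub_apply, smul_apply,
    mvfderiv_log_apply hρ hρx.ne', smul_eq_mul]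
  ring

namespace IsConformalChange

variable {g g' : Metric n p M} {ρ : M → ℝ}

theorem normT_pos (h : IsConformalChange D g g' ρ) (hx : 0 < normT g D x) :
    0 < normT g' D x := by
  rw [h.normT_eq]
  exact mul_pos (inv_pos.2 (h.pos x)) hx

theorem normLeafSecondFund_pos (h : IsConformalChange D g g' ρ)
    (hx : 0 < normLeafSecondFund g D x) : 0 < normLeafSecondFund g' D x := by
  rw [h.normLeafSecondFund_eq]
  exact mul_pos (inv_pos.2 (Real.sqrt_pos.2 (h.pos x))) hx

theorem normLeafSecondFund_sq_div_normT (h : IsConformalChange D g g' ρ) (x : M) :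
    normLeafSecondFund g' D x ^ 2 / normT g' D x =
      normLeafSecondFund g D x ^ 2 / normT g D x := by
  rw [h.normT_eq, h.normLeafSecondFund_eq, mul_pow, inv_pow, Real.sq_sqrt (h.pos x).le,
    mul_div_mul_left _ _ (inv_ne_zero (h.pos x).ne')]

theorem meanCurvature_sub_log_normT (h : IsConformalChange D g g' ρ) (hx : 0 < normT g D x) :
    meanCurvature g' D x - ((n : ℝ) / 2) •
        leafGradient g' D (fun y => Real.log (normT g' D y)) x =
      meanCurvature g D x - ((n : ℝ) / 2) •
        leafGradient g D (fun y => Real.log (normT g D y)) x := by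
  have ha := mdifferentiableAt_normT h.adapted hx
  have hb : ∀ᶠ y in nhds x,
      Real.log (normT g' D y) = Real.log (normT g D y) - 1 * Real.log (ρ y) := by
    filter_upwards [ha.continuousAt.eventually (lt_mem_nhds hx)] with y hy
    rw [h.normT_eq, Real.log_mul (inv_ne_zero (h.pos y).ne') hy.ne', Real.log_inv]
    ring
  rw [h.leafGradient_eq, leafGradient_log_eq h.adapted ha hx (h.mdifferentiable x) (h.pos x) hb,
    h.meanCurvature_eq, smul_sub, smul_smul, one_mul]
  abel

theorem meanCurvature_sub_log_normLeafSecondFund (h : IsConformalChange D g g' ρ)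
    (hx : 0 < normLeafSecondFund g D x) :
    meanCurvature g' D x - (n : ℝ) •
        leafGradient g' D (fun y => Real.log (normLeafSecondFund g' D y)) x =
      meanCurvature g D x - (n : ℝ) •
        leafGradient g D (fun y => Real.log (normLeafSecondFund g D y)) x := by
  have ha := mdifferentiableAt_normLeafSecondFund h.adapted hx
  have hb : ∀ᶠ y in nhds x, Real.log (normLeafSecondFund g' D y) =
      Real.log (normLeafSecondFund g D y) - (1 / 2) * Real.log (ρ y) := by
    filter_upwards [ha.continuousAt.eventually (lt_mem_nhds hx)] with y hy
    rw [h.normLeafSecondFund_eq, Real.log_mul (inv_ne_zero (Real.sqrt_pos.2 (h.pos y)).ne') hy.ne',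
      Real.log_inv, Real.log_sqrt (h.pos y).le]
    ring
  rw [h.leafGradient_eq, leafGradient_log_eq h.adapted ha hx (h.mdifferentiable x) (h.pos x) hb,
    h.meanCurvature_eq, smul_sub, smul_smul,
    show (n : ℝ) * (1 / 2 * (ρ x)⁻¹) = (n : ℝ) / 2 * (ρ x)⁻¹ by ring]
  abel

end IsConformalChange

theorem eq_of_hasDerivWithinAt_zero {J : Set ℝ} (hJ : Convex ℝ J) {f f' : ℝ → ℝ}
    (hf : ∀ t ∈ J, HasDerivWithinAt f (f' t) J t) (hf' : ∀ t ∈ J, f' t = 0) {a b : ℝ} (ha : a ∈ J)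
    (hb : b ∈ J) : f a = f b := by
  have h := hJ.norm_image_sub_le_of_norm_hasDerivWithin_le (C := 0) hf
    (fun t ht => by rw [hf' t ht, norm_zero]) hb ha
  rw [zero_mul] at h
  exact sub_eq_zero.1 (norm_le_zero_iff.1 h)

theorem convex_timeInterval (t₀ : EReal) : Convex ℝ (timeInterval t₀) := by
  refine OrdConnected.convex ⟨fun a ha b hb c hc => ⟨ha.1.trans hc.1, ?_⟩⟩
  exact lt_of_le_of_lt (EReal.coe_le_coe_iff.2 hc.2) hb.2

namespace IsConformalVariation

variable {J : Set ℝ} {g : ℝ → Metric n p M} {s : ℝ → M → ℝ} {a b : ℝ}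

theorem inner_tangent_eq (h : IsConformalVariation D J g s) (hJ : Convex ℝ J) (ha : a ∈ J)
    (hb : b ∈ J) {v w : TangentSpace (𝓡 (n + p)) x} (hv : v ∈ F.tangent x) :
    (g a).inner x v w = (g b).inner x v w := by
  refine eq_of_hasDerivWithinAt_zero hJ (fun t ht => h.evolution t ht x v w) (fun t ht => ?_) ha hb
  simp [D.perp_of_mem_tangent hv]

/-- Along `𝒟`, the ratio of two values of the metrics is constant in time. -/
theorem inner_carrier_eq (h : IsConformalVariation D J g s) (hJ : Convex ℝ J) (ha : a ∈ J)
    (hb : b ∈ J) {e v w : TangentSpace (𝓡 (n + p)) x} (he : e ∈ D.carrier x) (he0 : e ≠ 0)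
    (hv : v ∈ D.carrier x) (hw : w ∈ D.carrier x) :
    (g a).inner x v w = (g a).inner x e e / (g b).inner x e e * (g b).inner x v w := by
  have hpos : ∀ t, (g t).inner x e e ≠ 0 := fun t => ((g t).pos x e he0).ne'
  -- Numerator and denominator both satisfy `y' = s y`, so the quotient has zero derivative.
  have key : (g a).inner x v w / (g a).inner x e e = (g b).inner x v w / (g b).inner x e e := by
    refine eq_of_hasDerivWithinAt_zero hJ
      (f := fun t => (g t).inner x v w / (g t).inner x e e)
      (fun t ht => (h.evolution t ht x v w).div (h.evolution t ht x e e) (hpos t))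
      (fun t ht => ?_) ha hb
    rw [D.perp_of_mem he, D.perp_of_mem hv, D.perp_of_mem hw]
    ring
  rw [div_eq_div_iff (hpos a) (hpos b)] at key
  rw [div_mul_eq_mul_div, eq_div_iff (hpos b), key, mul_comm]

theorem exists_isConformalChange (h : IsConformalVariation D J g s) (hJ : Convex ℝ J) (ha : a ∈ J)
    (hb : b ∈ J) : ∃ ρ : M → ℝ, IsConformalChange D (g b) (g a) ρ := by
  -- For `n = 0` there is no nonzero vector of `𝒟` to define the ratio; the condition along `𝒟` is
  -- empty and `ρ = 1` serves.
  rcases Nat.eq_zero_or_pos n with hn | hn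
  · refine ⟨fun _ => 1, h.adapted b hb, h.adapted a ha, fun _ => one_pos,
      fun _ => mdifferentiableAt_const, fun x v hv w _ => h.inner_tangent_eq hJ ha hb hv,
      fun x v hv w _ => ?_⟩
    have h0 : D.carrier x = ⊥ := Submodule.finrank_eq_zero.1 ((D.finrank_carrier x).trans hn)
    rw [h0, Submodule.mem_bot] at hv
    simp [hv]
  · have hne : ∀ x, ∃ e ∈ D.carrier x, e ≠ 0 := fun x => by
      refine Submodule.exists_mem_ne_zero_of_ne_bot fun h0 => ?_
      have := D.finrank_carrier x
      rw [h0, finrank_bot] at this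
      omega
    choose e he he0 using hne
    refine ⟨fun x => (g a).inner x (e x) (e x) / (g b).inner x (e x) (e x), h.adapted b hb,
      h.adapted a ha, fun x => div_pos ((g a).pos x _ (he0 x)) ((g b).pos x _ (he0 x)),
      fun x => ?_, fun x v hv w _ => h.inner_tangent_eq hJ ha hb hv,
      fun x v hv w hw => h.inner_carrier_eq hJ ha hb (he x) (he0 x) hv hw⟩
    -- The vectors `e y` depend on `y` without any continuity, but the ratio does not depend on the
    -- vector. Near `x` it may be computed with a differentiable section of `𝒟` through `e x`.
    have hd := mdifferentiableAt_perpExtend D (e x)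
    have hda := mdifferentiableAt_inner (g a) hd hd
    have hdb := mdifferentiableAt_inner (g b) hd hd
    have hx : (g b).inner x (D.perpExtend (e x) x) (D.perpExtend (e x) x) ≠ 0 := by
      rw [D.perpExtend_self, D.perp_of_mem (he x)]
      exact ((g b).pos x _ (he0 x)).ne'
    have hq : MDifferentiableAt (𝓡 (n + p)) 𝓘(ℝ, ℝ) (fun y =>
        (g a).inner y (D.perpExtend (e x) y) (D.perpExtend (e x) y) *
        ((g b).inner y (D.perpExtend (e x) y) (D.perpExtend (e x) y))⁻¹) x :=
      hda.mul (DifferentiableAt.comp_mdifferentiableAt (g := fun r : ℝ => r⁻¹)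
        (f := fun y => (g b).inner y (D.perpExtend (e x) y) (D.perpExtend (e x) y))
        (differentiableAt_inv hx) hdb)
    refine hq.congr_of_eventuallyEq ?_
    filter_upwards [hdb.continuousAt.eventually_ne hx] with y hy
    have hy0 : D.perpExtend (e x) y ≠ 0 := by
      intro h0
      simp [h0] at hy
    have hmem : D.perpExtend (e x) y ∈ D.carrier y := D.perp_mem _
    have := h.inner_carrier_eq hJ ha hb (he y) (he0 y) hmem hmem
    rw [← div_eq_mul_inv, this, mul_div_assoc, div_self hy, mul_one]

end IsConformalVariation

theorem pos_of_mem_domainU {g : Metric n p M} {u₀ : M → ℝ} (hx : x ∈ domainU g D u₀) :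
    0 < normT g D x ∧ 0 < normLeafSecondFund g D x := by
  have hx' : (u₀ x ^ 2 * normLeafSecondFund g D x ^ 2) * (u₀ x ^ 4 * normT g D x ^ 2) ≠ 0 := hx
  constructor
  · refine (Real.sqrt_nonneg _).lt_of_ne' fun h => hx' ?_
    rw [show normT g D x = 0 from h]
    ring
  · refine (Real.sqrt_nonneg _).lt_of_ne' fun h => hx' ?_
    rw [show normLeafSecondFund g D x = 0 from h]
    ring

end Variation

end

end FoliatedFlow

theorem mainTheorem8 {n p : ℕ} {M : Type*} [TopologicalSpace M]
    [ChartedSpace (FoliatedFlow.Model n p) M] [IsManifold (𝓡 (n + p)) ∞ M]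
    [T2Space M] [SecondCountableTopology M]
    (F : FoliatedFlow.Foliation n p M) (D : FoliatedFlow.TransversalDistribution F)
    (t₀ : EReal) (ht₀ : 0 < t₀)
    (g : ℝ → FoliatedFlow.Metric n p M) (s : ℝ → M → ℝ)
    (hg : FoliatedFlow.IsConformalVariation D (FoliatedFlow.timeInterval t₀) g s)
    (u₀ : M → ℝ) (hu₀ : ContMDiff (𝓡 (n + p)) 𝓘(ℝ, ℝ) ∞ u₀) (hu₀_pos : ∀ x, 0 < u₀ x)
    (hH : ∀ x, FoliatedFlow.meanCurvature (g 0) D x =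
      -(n : ℝ) • FoliatedFlow.leafGradient (g 0) D (fun y => Real.log (u₀ y)) x) :
    ∀ t ∈ FoliatedFlow.timeInterval t₀,
      (∀ x, FoliatedFlow.beta (g t) D x = FoliatedFlow.beta (g 0) D x) ∧
      (∀ x ∈ FoliatedFlow.domainU (g 0) D u₀,
        (0 < FoliatedFlow.normT (g t) D x ∧
          MDifferentiableAt (𝓡 (n + p)) 𝓘(ℝ, ℝ) (FoliatedFlow.normT (g t) D) x) ∧
        (0 < FoliatedFlow.normLeafSecondFund (g t) D x ∧
          MDifferentiableAt (𝓡 (n + p)) 𝓘(ℝ, ℝ) (FoliatedFlow.normLeafSecondFund (g t) D) x) ∧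
        FoliatedFlow.normLeafSecondFund (g t) D x ^ 2 / FoliatedFlow.normT (g t) D x =
          FoliatedFlow.normLeafSecondFund (g 0) D x ^ 2 / FoliatedFlow.normT (g 0) D x ∧
        FoliatedFlow.meanCurvature (g t) D x - ((n : ℝ) / 2) •
            FoliatedFlow.leafGradient (g t) D
              (fun y => Real.log (FoliatedFlow.normT (g t) D y)) x =
          FoliatedFlow.meanCurvature (g 0) D x - ((n : ℝ) / 2) •
            FoliatedFlow.leafGradient (g 0) D
              (fun y => Real.log (FoliatedFlow.normT (g 0) D y)) x ∧
        FoliatedFlow.meanCurvature (g t) D x - (n : ℝ) •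
            FoliatedFlow.leafGradient (g t) D
              (fun y => Real.log (FoliatedFlow.normLeafSecondFund (g t) D y)) x =
          FoliatedFlow.meanCurvature (g 0) D x - (n : ℝ) •
            FoliatedFlow.leafGradient (g 0) D
              (fun y => Real.log (FoliatedFlow.normLeafSecondFund (g 0) D y)) x) ∧
      (∀ (u : M → ℝ) (x : M), ContMDiffAt (𝓡 (n + p)) 𝓘(ℝ, ℝ) 2 u x →
        FoliatedFlow.schrodinger (g t) D u x = FoliatedFlow.schrodinger (g 0) D u x) := by

  intro t ht
  have h0 : (0 : ℝ) ∈ FoliatedFlow.timeInterval t₀ := ⟨le_rfl, by exact_mod_cast ht₀⟩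
  obtain ⟨ρ, h⟩ := hg.exists_isConformalChange (FoliatedFlow.convex_timeInterval t₀) ht h0
  refine ⟨h.beta_eq, fun x hx => ?_, fun u x hu => h.schrodinger_eq hu⟩
  obtain ⟨hT, hF⟩ := FoliatedFlow.pos_of_mem_domainU hx
  have hT' := h.normT_pos hT
  have hF' := h.normLeafSecondFund_pos hF
  exact ⟨⟨hT', FoliatedFlow.mdifferentiableAt_normT h.adapted' hT'⟩,
    ⟨hF', FoliatedFlow.mdifferentiableAt_normLeafSecondFund h.adapted' hF'⟩,
    h.normLeafSecondFund_sq_div_normT x, h.meanCurvature_sub_log_normT hT,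
    h.meanCurvature_sub_log_normLeafSecondFund hF⟩
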